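/- Let $P_0(D)=\sum_{|\alpha|\le m}a_\alpha D^\alpha$, $a_\alpha\in\mathbb{R}$, $D_j=-i\,\partial/\partial x_j$, be a constant coefficient differential operator of order $m\ge 2$ on $\mathbb{R}^n$ with $\widetilde P_0(\xi)=\big(\sum_{\alpha}|\partial^\alpha P_0(\xi)|^2\big)^{1/2}\to\infty$ as $|\xi|\to\infty$. Let $\Omega\subset\mathbb{R}^n$ be a bounded domain and let $V\in L^\infty(\mathbb{R}^n)$ be real-valued with $\operatorname{supp}V=\overline\Omega$ and $V\ge\delta>0$ a.e. in $\overline\Omega$. Let $H_0^{P_0}(\Omega)\subset L^2(\Omega)$ be the completion of $C_0^\infty(\Omega)$ in the norm $\|\varphi\|_{P_0}=\|P_0(D)\varphi\|_{L^2(\Omega)}$, and for $\lambda\in\mathbb{R}$ put $$B_\lambda(u,v)=\Big\langle \tfrac1V(P_0-\lambda)u,\,(P_0+V-\lambda)v\Big\rangle_{L^2(\Omega)},\qquad u,v\in H_0^{P_0}(\Omega).$$ A number $\lambda\in\mathbb{C}$ is a transmission eigenvalue if there are $0\ne v\in L^2_{\rm loc}(\Omega)$ and $0\neq w\in L^2_{\rm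 loc}(\Omega)$ with $(P_0-\lambda)v=0$ and $(P_0+V-\lambda)w=0$ in $\mathcal{D}'(\Omega)$ and $v-w\in H_0^{P_0}(\Omega)$. Call $\lambda_0\in\mathbb{R}$ a coercivity point if there is $c>0$ with $B_{\lambda_0}(u,u)\ge c\|u\|_{P_0}^2$ for all $u\in H_0^{P_0}(\Omega)$. (i) If $P_0(\xi)$ or $-P_0(\xi)$ is bounded from below on $\mathbb{R}^n$, then a coercivity point exists. (ii) Let $\lambda_0$ be any coercivity point. If for some $\lambda\in\mathbb{R}$ there is $0\ne u\in H_0^{P_0}(\Omega)$ with $B_\lambda(u,u)\le 0$, then there is a transmission eigenvalue $\lambda^*\in(\lambda_0,\lambda]$ if $\lambda_0<\lambda$, and a transmission eigenvalue $\lambda^*\in[\lambda,\lambda_0)$ if $\lambda_0>\lambda$. -/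

import Mathlib

open MeasureTheory Filter Topology
open scoped ENNReal Distributions

noncomputable section

namespace ITP

/-- `ℝⁿ` with its Euclidean norm and Lebesgue measure. -/
abbrev E (n : ℕ) : Type := EuclideanSpace ℝ (Fin n)

/-- `D_j = -i ∂/∂x_j`. -/
def D {n : ℕ} (j : Fin n) (φ : E n → ℂ) : E n → ℂ :=
  fun x => -Complex.I * fderiv ℝ φ x (EuclideanSpace.single j 1)

/-- `D^α = D_1^{α_1} ⋯ D_n^{α_n}`, for a multi-index `α`. -/
def DPow {n : ℕ} (α : Fin n →₀ ℕ) (φ : E n → ℂ) : E n → ℂ :=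
  (List.finRange n).foldr (fun j g => (D j)^[α j] g) φ

/-- The constant coefficient operator `P(D) = ∑ a_α D^α` with real symbol `P(ξ) = ∑ a_α ξ^α`. -/
def opD {n : ℕ} (P : MvPolynomial (Fin n) ℝ) (φ : E n → ℂ) : E n → ℂ :=
  fun x => ∑ α ∈ P.support, ((P.coeff α : ℝ) : ℂ) * DPow α φ x

/-- The transpose `P(-D) = ∑ (-1)^{|α|} a_α D^α` of `P(D)` for the bilinear pairing `∫ f g`. -/
def opDTranspose {n : ℕ} (P : MvPolynomial (Fin n) ℝ) (φ : E n → ℂ) : E n → ℂ :=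
  fun x => ∑ α ∈ P.support, (-1 : ℂ) ^ (∑ j, α j) * ((P.coeff α : ℝ) : ℂ) * DPow α φ x

/-- The value `P(ξ)` of the symbol. -/
def symbol {n : ℕ} (P : MvPolynomial (Fin n) ℝ) (ξ : E n) : ℝ :=
  MvPolynomial.eval (fun j => ξ j) P

/-- `∂^α P`, for a multi-index `α`. -/
def derivPoly {n : ℕ} (P : MvPolynomial (Fin n) ℝ) (α : Fin n → ℕ) : MvPolynomial (Fin n) ℝ :=
  (List.finRange n).foldr (fun j Q => (fun R => MvPolynomial.pderiv j R)^[α j] Q) P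

/-- `P̃(ξ) = (∑_α |P^{(α)}(ξ)|²)^{1/2}`. Multi-indices with an entry above the total degree of `P`
are left out, since the corresponding derivatives of `P` are zero. -/
def symbolTilde {n : ℕ} (P : MvPolynomial (Fin n) ℝ) (ξ : E n) : ℝ :=
  Real.sqrt (∑ α : Fin n → Fin (P.totalDegree + 1),
    symbol (derivPoly P (fun j => (α j : ℕ))) ξ ^ 2)

/-- One of the symbols `P` and `-P` is bounded from below on `ℝⁿ`. -/
def SemiboundedSymbol {n : ℕ} (P : MvPolynomial (Fin n) ℝ) : Prop :=
  (∃ C : ℝ, ∀ ξ : E n, C ≤ symbol P ξ) ∨ (∃ C : ℝ, ∀ ξ : E n, C ≤ -symbol P ξ)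

/-- The support of a function regarded as a distribution (almost everywhere class): the complement
of the largest open set on which it vanishes almost everywhere. -/
def essSupport {n : ℕ} (V : E n → ℝ) : Set (E n) :=
  {x | ∀ U ∈ 𝓝 x, ¬ V =ᵐ[volume.restrict U] 0}

/-- `L²(Ω)`. -/
abbrev L2 {n : ℕ} (Ω : TopologicalSpace.Opens (E n)) : Type :=
  Lp ℂ 2 ((volume : Measure (E n)).restrict (Ω : Set (E n)))

/-- The space `H_0^{P}(Ω)`: the completion of `C_0^∞(Ω)` for the norm `‖P(D)φ‖_{L²}`, realised as a
space of functions. Because `‖φ‖ ≤ C_Ω ‖P(D)φ‖` on `C_0^∞(Ω)` for bounded `Ω`, a sequence of test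
functions that is Cauchy for this norm has an `L²(Ω)` limit `u`, and its elements are such limits.
An element is recorded as the pair `(u, P(D)u)`, so that the space is the closure in
`L²(Ω) × L²(Ω)` of the graph of `P(D)` on test functions and the norm of `p` is `‖p.2‖`. -/
def H0 {n : ℕ} (P : MvPolynomial (Fin n) ℝ) (Ω : TopologicalSpace.Opens (E n)) :
    Set (L2 Ω × L2 Ω) :=
  closure {p | ∃ φ : 𝓓(Ω, ℂ),
    p.1 =ᵐ[volume.restrict (Ω : Set (E n))] φ ∧
    p.2 =ᵐ[volume.restrict (Ω : Set (E n))] opD P φ}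

/-- The form `B_λ(u,v) = ⟨V⁻¹ (P(D) - λ) u, (P(D) + V - λ) v⟩_{L²(Ω)}`, for real `λ`, on pairs
`u = (u, P(D)u)`, `v = (v, P(D)v)` in `H_0^P(Ω)`. -/
def B {n : ℕ} (V : E n → ℝ) (Ω : TopologicalSpace.Opens (E n)) (lam : ℝ) (u v : L2 Ω × L2 Ω) : ℂ :=
  ∫ x in (Ω : Set (E n)), ((1 / V x : ℝ) : ℂ) * (u.2 x - (lam : ℂ) * u.1 x) *
    (starRingEnd ℂ) (v.2 x + (V x : ℂ) * v.1 x - (lam : ℂ) * v.1 x)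

/-- `B_λ` is coercive on `H_0^P(Ω)`: `B_λ(u,u) ≥ c ‖P(D)u‖²` for some `c > 0`. -/
def IsCoerciveAt {n : ℕ} (P : MvPolynomial (Fin n) ℝ) (V : E n → ℝ)
    (Ω : TopologicalSpace.Opens (E n)) (lam : ℝ) : Prop :=
  ∃ c : ℝ, 0 < c ∧ ∀ u ∈ H0 P Ω, c * ‖u.2‖ ^ 2 ≤ (B V Ω lam u u).re

/-- `v ∈ L²_loc(Ω)`. -/
def MemL2Loc {n : ℕ} (Ω : TopologicalSpace.Opens (E n)) (v : E n → ℂ) : Prop :=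
  ∀ K : Set (E n), IsCompact K → K ⊆ (Ω : Set (E n)) → MemLp v 2 (volume.restrict K)

/-- `(P(D) + W - λ) v = 0` in `𝓓'(Ω)`. -/
def SolvesWeakly {n : ℕ} (P : MvPolynomial (Fin n) ℝ) (W : E n → ℝ)
    (Ω : TopologicalSpace.Opens (E n)) (lam : ℂ) (v : E n → ℂ) : Prop :=
  ∀ φ : 𝓓(Ω, ℂ), ∫ x in (Ω : Set (E n)),
    v x * (opDTranspose P φ x + (W x : ℂ) * φ x - lam * φ x) = 0

/-- `λ ∈ ℂ` is a transmission eigenvalue: there are nonzero `v, w ∈ L²_loc(Ω)` with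
`(P(D) - λ) v = 0` and `(P(D) + V - λ) w = 0` in `Ω` and `v - w ∈ H_0^P(Ω)`. -/
def IsTransmissionEigenvalue {n : ℕ} (P : MvPolynomial (Fin n) ℝ) (V : E n → ℝ)
    (Ω : TopologicalSpace.Opens (E n)) (lam : ℂ) : Prop :=
  ∃ v w : E n → ℂ, MemL2Loc Ω v ∧ MemL2Loc Ω w ∧
    ¬ v =ᵐ[volume.restrict (Ω : Set (E n))] 0 ∧
    ¬ w =ᵐ[volume.restrict (Ω : Set (E n))] 0 ∧
    SolvesWeakly P (fun _ => 0) Ω lam v ∧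
    SolvesWeakly P V Ω lam w ∧
    ∃ u ∈ H0 P Ω, u.1 =ᵐ[volume.restrict (Ω : Set (E n))] fun x => v x - w x

end ITP

end

/-!
On functions supported in a fixed ball, Hörmander's commutator argument bounds `‖P^{(α)}(D) f‖` by
`‖P(D) f‖`. Together with `P̃ → ∞` this makes `H_0^P(Ω) → L²(Ω)` compact. The constants do not see
translations of the symbol, so conjugating with `e^{⟨η, x⟩}` gives a Carleman estimate: `u = 0` as
soon as `u ∈ H_0^P(Ω)` and `|(P(D) - λ) u| ≤ M |u|` almost everywhere.

The coercivity points form an open set and the `λ` with `B_λ ≥ 0` a closed one, so between a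
coercivity point and a `λ` that is none there is a `μ` for which `B_μ` is nonnegative but not
coercive. By compactness such a `B_μ` has a nonzero null vector `u`, which lies in the kernel of
`B_μ` by the Cauchy–Schwarz inequality. Then `w = V⁻¹ (P(D) - μ) u` and `v = u + w` solve the two
equations weakly, and neither of them vanishes by the Carleman estimate.
-/

noncomputable section

namespace ITP

open SchwartzMap
open MvPolynomial (C X pderiv)
open scoped SchwartzMap FourierTransform ComplexConjugate

variable {n : ℕ}

/-- The value `q(2πξ)`, which is the Fourier multiplier of `q(D)` in Mathlib's normalisation. -/
def multiplier (q : MvPolynomial (Fin n) ℂ) (ξ : E n) : ℂ :=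
  MvPolynomial.eval (fun j => ((2 * Real.pi * ξ j : ℝ) : ℂ)) q

theorem hasTemperateGrowth_coord (j : Fin n) :
    (fun x : E n => ((x j : ℝ) : ℂ)).HasTemperateGrowth :=
  (Complex.ofRealCLM.comp (EuclideanSpace.proj (𝕜 := ℝ) j)).hasTemperateGrowth

theorem hasTemperateGrowth_multiplier (q : MvPolynomial (Fin n) ℂ) :
    (multiplier q).HasTemperateGrowth := by
  induction q using MvPolynomial.induction_on with
  | C a =>
    have : multiplier (C a) = fun _ : E n => a := by ext; simp [multiplier]
    exact this ▸ .const a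
  | add p q hp hq =>
    have : multiplier (p + q) = multiplier p + multiplier q := by ext; simp [multiplier]
    exact this ▸ hp.add hq
  | mul_X p j hp =>
    have : multiplier (p * X j) =
        multiplier p * ((fun _ => ((2 * Real.pi : ℝ) : ℂ)) * fun x : E n => ((x j : ℝ) : ℂ)) := by
      ext; simp [multiplier]
    exact this ▸ hp.mul ((Function.HasTemperateGrowth.const _).mul (hasTemperateGrowth_coord j))

theorem fourier_fourierMultiplierCLM_apply {g : E n → ℂ} (hg : g.HasTemperateGrowth)
    (f : 𝓢(E n, ℂ)) (ξ : E n) : 𝓕 (fourierMultiplierCLM ℂ g f) ξ = g ξ * 𝓕 f ξ := by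
  rw [fourierMultiplierCLM_apply, FourierTransform.fourier_fourierInv_eq,
    smulLeftCLM_apply_apply hg, smul_eq_mul]

theorem ext_fourier {f g : 𝓢(E n, ℂ)} (h : ∀ ξ, 𝓕 f ξ = 𝓕 g ξ) : f = g :=
  (FourierTransform.fourierEquiv ℂ 𝓢(E n, ℂ)).injective (SchwartzMap.ext h)

theorem fourier_add_apply (f g : 𝓢(E n, ℂ)) (ξ : E n) : 𝓕 (f + g) ξ = 𝓕 f ξ + 𝓕 g ξ := by
  rw [FourierTransform.fourier_add, add_apply]

theorem fourier_smul_apply (a : ℂ) (f : 𝓢(E n, ℂ)) (ξ : E n) : 𝓕 (a • f) ξ = a * 𝓕 f ξ := by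
  rw [FourierTransform.fourier_smul, smul_apply, smul_eq_mul]

/-- The operator `q(D)` on Schwartz functions, as a homomorphism from the algebra of polynomials
to the algebra of operators. It is defined by its Fourier multiplier. -/
def diffOp : MvPolynomial (Fin n) ℂ →ₐ[ℂ] (𝓢(E n, ℂ) →L[ℂ] 𝓢(E n, ℂ)) :=
  AlgHom.ofLinearMap
    { toFun := fun q => fourierMultiplierCLM ℂ (multiplier q)
      map_add' := fun p q => by
        ext1 f
        refine ext_fourier fun ξ => ?_
        simp only [add_apply, fourier_add_apply,
          fourier_fourierMultiplierCLM_apply (hasTemperateGrowth_multiplier _)]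
        simp only [multiplier, map_add, add_mul]
      map_smul' := fun a q => by
        ext1 f
        refine ext_fourier fun ξ => ?_
        simp only [smul_apply, fourier_smul_apply, RingHom.id_apply,
          fourier_fourierMultiplierCLM_apply (hasTemperateGrowth_multiplier _)]
        simp only [multiplier, MvPolynomial.smul_eval, mul_assoc] }
    (by
      ext1 f
      refine ext_fourier fun ξ => ?_
      simp [fourier_fourierMultiplierCLM_apply (hasTemperateGrowth_multiplier _), multiplier])
    (fun p q => by
      ext1 f
      refine ext_fourier fun ξ => ?_
      simp only [LinearMap.coe_mk, AddHom.coe_mk, mul_apply_eq_comp,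
        fourier_fourierMultiplierCLM_apply (hasTemperateGrowth_multiplier _)]
      simp only [multiplier, map_mul, mul_assoc])

theorem fourier_diffOp_apply (q : MvPolynomial (Fin n) ℂ) (f : 𝓢(E n, ℂ)) (ξ : E n) :
    𝓕 (diffOp q f) ξ = multiplier q ξ * 𝓕 f ξ :=
  fourier_fourierMultiplierCLM_apply (hasTemperateGrowth_multiplier q) f ξ

theorem diffOp_mul_apply (p q : MvPolynomial (Fin n) ℂ) (f : 𝓢(E n, ℂ)) :
    diffOp (p * q) f = diffOp p (diffOp q f) := by
  rw [map_mul, mul_apply_eq_comp]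

theorem diffOp_C (a : ℂ) (f : 𝓢(E n, ℂ)) : diffOp (C a) f = a • f := by
  rw [MvPolynomial.algHom_C, Algebra.algebraMap_eq_smul_one, smul_apply, one_apply_eq_self]

theorem diffOp_X (j : Fin n) (f : 𝓢(E n, ℂ)) :
    diffOp (X j) f =
      (-Complex.I) • LineDeriv.lineDerivOp (EuclideanSpace.single j (1 : ℝ) : E n) f := by
  refine ext_fourier fun ξ => ?_
  rw [fourier_smul_apply, fourier_diffOp_apply, SchwartzMap.fourier_lineDerivOp_eq,
    smul_apply, smulLeftCLM_apply_apply (by fun_prop)]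
  simp only [multiplier, MvPolynomial.eval_X, EuclideanSpace.inner_single_right, smul_eq_mul,
    Complex.real_smul, conj_trivial]
  push_cast
  linear_combination (2 * Real.pi * (ξ j : ℂ) * 𝓕 f ξ) * Complex.I_mul_I

theorem coe_diffOp_X (j : Fin n) (f : 𝓢(E n, ℂ)) : ⇑(diffOp (X j) f) = D j f := by
  ext x
  simp [diffOp_X, D, SchwartzMap.lineDerivOp_apply_eq_fderiv]

theorem tsupport_diffOp_subset (q : MvPolynomial (Fin n) ℂ) (f : 𝓢(E n, ℂ)) :
    tsupport (diffOp q f) ⊆ tsupport f := by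
  induction q using MvPolynomial.induction_on generalizing f with
  | C a =>
    rw [diffOp_C]
    exact tsupport_smul_subset_right (fun _ => a) f
  | add p q hp hq =>
    rw [map_add]
    exact (tsupport_add (diffOp p f) (diffOp q f)).trans (Set.union_subset (hp f) (hq f))
  | mul_X p j hp =>
    rw [diffOp_mul_apply]
    refine (hp _).trans ?_
    rw [diffOp_X]
    exact (tsupport_smul_subset_right (fun _ => -Complex.I) _).trans
      (tsupport_lineDerivOp_subset _ f)

/-- Multiplication by the coordinate `x_j` on Schwartz functions. -/
def mulCoord (j : Fin n) : 𝓢(E n, ℂ) →L[ℂ] 𝓢(E n, ℂ) :=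
  smulLeftCLM ℂ fun x : E n => ((x j : ℝ) : ℂ)

theorem mulCoord_apply (j : Fin n) (f : 𝓢(E n, ℂ)) (x : E n) :
    mulCoord j f x = (x j : ℂ) * f x :=
  smulLeftCLM_apply_apply (hasTemperateGrowth_coord j) f x

theorem diffOp_X_mulCoord (i j : Fin n) (f : 𝓢(E n, ℂ)) :
    diffOp (X i) (mulCoord j f) =
      mulCoord j (diffOp (X i) f) - (if i = j then Complex.I else 0) • f := by
  ext x
  have hcoord : HasFDerivAt (fun x : E n => ((x j : ℝ) : ℂ))
      (Complex.ofRealCLM.comp (EuclideanSpace.proj (𝕜 := ℝ) j)) x :=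
    (Complex.ofRealCLM.comp (EuclideanSpace.proj (𝕜 := ℝ) j : E n →L[ℝ] ℝ)).hasFDerivAt
  have hprod : HasFDerivAt (fun x : E n => (x j : ℂ) * f x) _ x := hcoord.mul (f.hasFDerivAt x)
  have hmul : ⇑(mulCoord j f) = fun x => (x j : ℂ) * f x := funext (mulCoord_apply j f)
  rw [sub_apply, mulCoord_apply, coe_diffOp_X, coe_diffOp_X, D, D, hmul, hprod.fderiv, smul_apply]
  by_cases hij : i = j
  · subst hij; simp; ring
  · simp [hij, Ne.symm hij]; ring

theorem diffOp_mulCoord (q : MvPolynomial (Fin n) ℂ) (j : Fin n) (f : 𝓢(E n, ℂ)) :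
    diffOp q (mulCoord j f) =
      mulCoord j (diffOp q f) - Complex.I • diffOp (pderiv j q) f := by
  induction q using MvPolynomial.induction_on generalizing f with
  | C a => simp
  | add p q hp hq =>
    simp only [map_add, add_apply, hp, hq, smul_add]; abel
  | mul_X p i hp =>
    simp only [diffOp_mul_apply, diffOp_X_mulCoord, map_sub, hp, map_smul, Derivation.leibniz,
      smul_eq_mul, map_add, add_apply, MvPolynomial.pderiv_X,
      mul_comm (X i) (pderiv j p)]
    by_cases hij : i = j
    · subst hij; simp; abel
    · simp [hij]

/-- The inclusion of the Schwartz functions in `L²(ℝⁿ)`. -/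
def toL2 : 𝓢(E n, ℂ) →L[ℂ] Lp ℂ 2 (volume : Measure (E n)) := toLpCLM ℂ ℂ 2 volume

theorem coeFn_toL2 (f : 𝓢(E n, ℂ)) : toL2 f =ᵐ[volume] f := f.coeFn_toLp 2 volume

theorem inner_toL2 (f g : 𝓢(E n, ℂ)) : inner ℂ (toL2 f) (toL2 g) = ∫ x, inner ℂ (f x) (g x) :=
  inner_toL2_toL2_eq f g volume

theorem norm_toL2_fourier (f : 𝓢(E n, ℂ)) : ‖toL2 (𝓕 f)‖ = ‖toL2 f‖ := norm_fourier_toL2_eq f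

theorem norm_toL2_sq (f : 𝓢(E n, ℂ)) : ‖toL2 f‖ ^ 2 = ∫ x, ‖f x‖ ^ 2 := by
  have h := inner_toL2 f f
  simp only [inner_self_eq_norm_sq_to_K] at h
  exact_mod_cast h

theorem norm_toL2_le_of_norm_le {f g : 𝓢(E n, ℂ)} {c : ℝ} (h : ∀ x, ‖f x‖ ≤ c * ‖g x‖) :
    ‖toL2 f‖ ≤ c * ‖toL2 g‖ := by
  refine Lp.norm_le_mul_norm_of_ae_le_mul ?_
  filter_upwards [coeFn_toL2 f, coeFn_toL2 g] with x hf hg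
  rw [hf, hg]
  exact h x

theorem norm_diffOp_le {p q : MvPolynomial (Fin n) ℂ} {c : ℝ}
    (h : ∀ ξ, ‖multiplier p ξ‖ ≤ c * ‖multiplier q ξ‖) (f : 𝓢(E n, ℂ)) :
    ‖toL2 (diffOp p f)‖ ≤ c * ‖toL2 (diffOp q f)‖ := by
  rw [← norm_toL2_fourier, ← norm_toL2_fourier (diffOp q f)]
  refine norm_toL2_le_of_norm_le fun ξ => ?_
  rw [fourier_diffOp_apply, fourier_diffOp_apply, norm_mul, norm_mul, ← mul_assoc]
  gcongr
  exact h ξ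

/-- The polynomial with conjugate coefficients, the symbol of the formal adjoint of `q(D)`. -/
abbrev conjPoly (q : MvPolynomial (Fin n) ℂ) : MvPolynomial (Fin n) ℂ :=
  MvPolynomial.map (starRingEnd ℂ) q

theorem conjPoly_conjPoly (q : MvPolynomial (Fin n) ℂ) : conjPoly (conjPoly q) = q := by
  ext m; simp [MvPolynomial.coeff_map]

theorem multiplier_conjPoly (q : MvPolynomial (Fin n) ℂ) (ξ : E n) :
    multiplier (conjPoly q) ξ = conj (multiplier q ξ) := by
  simp only [multiplier, MvPolynomial.eval_map]
  rw [MvPolynomial.eval, MvPolynomial.coe_eval₂Hom, MvPolynomial.hom_eval₂]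
  simp only [Complex.conj_ofReal, RingHomCompTriple.comp_eq]

theorem norm_diffOp_conjPoly (q : MvPolynomial (Fin n) ℂ) (f : 𝓢(E n, ℂ)) :
    ‖toL2 (diffOp (conjPoly q) f)‖ = ‖toL2 (diffOp q f)‖ := by
  refine le_antisymm ?_ ?_ <;> refine (norm_diffOp_le (c := 1) (fun ξ => ?_) f).trans_eq (one_mul _)
    <;> rw [multiplier_conjPoly, RCLike.norm_conj, one_mul]

theorem inner_diffOp_left (q : MvPolynomial (Fin n) ℂ) (f g : 𝓢(E n, ℂ)) :
    inner ℂ (toL2 (diffOp q f)) (toL2 g) = inner ℂ (toL2 f) (toL2 (diffOp (conjPoly q) g)) := by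
  have plancherel (f g : 𝓢(E n, ℂ)) :
      inner ℂ (toL2 f) (toL2 g) = ∫ ξ, inner ℂ (𝓕 f ξ) (𝓕 g ξ) := by
    rw [← inner_toL2]
    exact (inner_fourier_toL2_eq f g).symm
  rw [plancherel, plancherel]
  congr 1 with ξ
  simp only [RCLike.inner_apply, fourier_diffOp_apply, multiplier_conjPoly, map_mul]
  ring

theorem norm_mulCoord_le {R : ℝ} (j : Fin n) {f : 𝓢(E n, ℂ)}
    (hf : tsupport f ⊆ Metric.closedBall 0 R) : ‖toL2 (mulCoord j f)‖ ≤ R * ‖toL2 f‖ := by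
  refine norm_toL2_le_of_norm_le fun x => ?_
  rw [mulCoord_apply, norm_mul, Complex.norm_real]
  by_cases hx : x ∈ tsupport f
  · gcongr
    exact (PiLp.norm_apply_le x j).trans (mem_closedBall_zero_iff.1 (hf hx))
  · simp [image_eq_zero_of_notMem_tsupport hx]

theorem norm_inner_diffOp_diffOp_le (p q : MvPolynomial (Fin n) ℂ) (f g : 𝓢(E n, ℂ)) :
    ‖inner ℂ (toL2 (diffOp p f)) (toL2 (diffOp q g))‖ ≤
      ‖toL2 (diffOp q f)‖ * ‖toL2 (diffOp (conjPoly p) g)‖ := by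
  have hswap : inner ℂ (toL2 (diffOp p f)) (toL2 (diffOp q g)) =
      inner ℂ (toL2 (diffOp (conjPoly q) f)) (toL2 (diffOp (conjPoly p) g)) := by
    rw [inner_diffOp_left p, ← diffOp_mul_apply, mul_comm, diffOp_mul_apply,
      inner_diffOp_left (conjPoly q), conjPoly_conjPoly]
  rw [hswap, ← norm_diffOp_conjPoly q]
  exact norm_inner_le_norm _ _

theorem sq_norm_diffOp_pderiv_le {R : ℝ} (j : Fin n) (q : MvPolynomial (Fin n) ℂ)
    {f : 𝓢(E n, ℂ)} (hf : tsupport f ⊆ Metric.closedBall 0 R) :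
    ‖toL2 (diffOp (pderiv j q) f)‖ ^ 2 ≤
      (2 * R * ‖toL2 (diffOp (pderiv j q) f)‖ + ‖toL2 (diffOp (pderiv j (pderiv j q)) f)‖) *
        ‖toL2 (diffOp q f)‖ := by
  set q' := pderiv j q
  have hcomm : Complex.I • diffOp q' f = mulCoord j (diffOp q f) - diffOp q (mulCoord j f) := by
    rw [diffOp_mulCoord]; abel
  have hsq : ‖toL2 (diffOp q' f)‖ ^ 2 =
      ‖inner ℂ (toL2 (diffOp q' f)) (toL2 (mulCoord j (diffOp q f))) -
        inner ℂ (toL2 (diffOp q' f)) (toL2 (diffOp q (mulCoord j f)))‖ := by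
    rw [← inner_sub_right, ← map_sub, ← hcomm, map_smul, inner_smul_right, norm_mul,
      Complex.norm_I, one_mul, inner_self_eq_norm_sq_to_K, norm_pow, RCLike.norm_ofReal, abs_norm]
  have hfirst : ‖toL2 (mulCoord j (diffOp q f))‖ ≤ R * ‖toL2 (diffOp q f)‖ :=
    norm_mulCoord_le j ((tsupport_diffOp_subset q f).trans hf)
  have hsecond : ‖toL2 (diffOp (conjPoly q') (mulCoord j f))‖ ≤
      R * ‖toL2 (diffOp q' f)‖ + ‖toL2 (diffOp (pderiv j q') f)‖ := by
    rw [diffOp_mulCoord, map_sub, MvPolynomial.pderiv_map, ← norm_diffOp_conjPoly q',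
      ← norm_diffOp_conjPoly (pderiv j q')]
    refine (norm_sub_le _ _).trans (add_le_add ?_ ?_)
    · exact norm_mulCoord_le j ((tsupport_diffOp_subset _ f).trans hf)
    · rw [map_smul, norm_smul, Complex.norm_I, one_mul]
  calc ‖toL2 (diffOp q' f)‖ ^ 2
      ≤ ‖toL2 (diffOp q' f)‖ * ‖toL2 (mulCoord j (diffOp q f))‖ +
          ‖toL2 (diffOp q f)‖ * ‖toL2 (diffOp (conjPoly q') (mulCoord j f))‖ :=
        hsq.trans_le <| (norm_sub_le _ _).trans <|
          add_le_add (norm_inner_le_norm _ _) (norm_inner_diffOp_diffOp_le q' q f _)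
    _ ≤ ‖toL2 (diffOp q' f)‖ * (R * ‖toL2 (diffOp q f)‖) +
          ‖toL2 (diffOp q f)‖ * (R * ‖toL2 (diffOp q' f)‖ + ‖toL2 (diffOp (pderiv j q') f)‖) := by
        gcongr
    _ = _ := by ring

/-- **Hörmander's inequality**. -/
theorem norm_diffOp_pderiv_le {R : ℝ} (hR : 0 ≤ R) (j : Fin n) (d : ℕ)
    {q : MvPolynomial (Fin n) ℂ} (hq : (pderiv j)^[d] q = 0) {f : 𝓢(E n, ℂ)}
    (hf : tsupport f ⊆ Metric.closedBall 0 R) :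
    ‖toL2 (diffOp (pderiv j q) f)‖ ≤ 2 * d * R * ‖toL2 (diffOp q f)‖ := by
  induction d generalizing q with
  | zero => simp [show q = 0 from hq]
  | succ d ih =>
    have hsecond := ih (q := pderiv j q) hq
    have hsq := sq_norm_diffOp_pderiv_le j q hf
    set a := ‖toL2 (diffOp q f)‖
    set b := ‖toL2 (diffOp (pderiv j q) f)‖
    rcases (show 0 ≤ b from norm_nonneg _).eq_or_lt with hb | hb
    · rw [← hb]; positivity
    · refine le_of_mul_le_mul_left ?_ hb
      calc b * b = b ^ 2 := (sq b).symm
        _ ≤ (2 * R * b + 2 * d * R * b) * a := hsq.trans (by gcongr)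
        _ = b * (2 * ↑(d + 1) * R * a) := by push_cast; ring

section Polynomial

variable {σ R : Type*} [CommSemiring R]

theorem totalDegree_pderiv_le (j : σ) (q : MvPolynomial σ R) :
    (pderiv j q).totalDegree ≤ q.totalDegree - 1 := by
  refine Finset.sup_le fun m hm => ?_
  rw [MvPolynomial.mem_support_iff, MvPolynomial.coeff_pderiv] at hm
  have h := MvPolynomial.le_totalDegree
    (MvPolynomial.mem_support_iff.2 (left_ne_zero_of_mul hm))
  rw [Finsupp.sum_add_index' (fun _ => rfl) (fun _ _ _ => rfl), Finsupp.sum_single_index rfl] at h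
  lia

theorem iterate_pderiv_eq_zero (j : σ) {d : ℕ} {q : MvPolynomial σ R} (hq : q.totalDegree < d) :
    (pderiv j)^[d] q = 0 := by
  induction d generalizing q with
  | zero => lia
  | succ d ih =>
    rw [Function.iterate_succ_apply]
    rcases q.totalDegree.eq_zero_or_pos with h | h
    · rw [MvPolynomial.totalDegree_eq_zero_iff_eq_C.1 h, MvPolynomial.pderiv_C]
      exact iterate_map_zero (pderiv j) d
    · exact ih ((totalDegree_pderiv_le j q).trans_lt (by lia))

/-- The polynomial `q(X + s)`. -/
def translate (s : σ → R) : MvPolynomial σ R →ₐ[R] MvPolynomial σ R :=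
  MvPolynomial.aeval fun k => X k + C (s k)

theorem translate_X (s : σ → R) (k : σ) : translate s (X k) = X k + C (s k) :=
  MvPolynomial.aeval_X _ k

theorem translate_C (s : σ → R) (a : R) : translate s (C a) = C a := MvPolynomial.algHom_C _ a

theorem translate_zero : translate (0 : σ → R) = AlgHom.id R _ := by
  ext1 k
  simp [translate_X]

theorem pderiv_translate (s : σ → R) (j : σ) (q : MvPolynomial σ R) :
    pderiv j (translate s q) = translate s (pderiv j q) := by
  classical
  induction q using MvPolynomial.induction_on with
  | C a => simp
  | add p q hp hq => simp only [map_add, hp, hq]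
  | mul_X p k hp =>
    have hX : pderiv j (translate s (X k)) = translate s (pderiv j (X k)) := by
      rw [translate_X, map_add, MvPolynomial.pderiv_C, add_zero, MvPolynomial.pderiv_X]
      rcases eq_or_ne k j with rfl | hkj
      · simp
      · simp [hkj]
    simp only [map_mul, Derivation.leibniz, smul_eq_mul, map_add, hp, hX]

theorem eval_translate (s x : σ → R) (q : MvPolynomial σ R) :
    MvPolynomial.eval x (translate s q) = MvPolynomial.eval (x + s) q := by
  induction q using MvPolynomial.induction_on with
  | C a => simp
  | add p q hp hq => simp only [map_add, hp, hq]
  | mul_X p k hp => simp [hp, translate_X]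

end Polynomial

/-- `q(D)` is weaker than `p(D)` on functions supported in the ball of radius `R`. The estimate is
required for all translates of the pair with the same constant, which makes it an estimate in
exponentially weighted norms as well. -/
def IsWeakerOn (R : ℝ) (q p : MvPolynomial (Fin n) ℂ) : Prop :=
  ∃ K ≥ 0, ∀ (s : Fin n → ℂ) (f : 𝓢(E n, ℂ)), tsupport f ⊆ Metric.closedBall 0 R →
    ‖toL2 (diffOp (translate s q) f)‖ ≤ K * ‖toL2 (diffOp (translate s p) f)‖

theorem IsWeakerOn.refl (R : ℝ) (p : MvPolynomial (Fin n) ℂ) : IsWeakerOn R p p :=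
  ⟨1, zero_le_one, fun _ _ _ => (one_mul _).ge⟩

theorem IsWeakerOn.trans {R : ℝ} {p q r : MvPolynomial (Fin n) ℂ} (hpq : IsWeakerOn R p q)
    (hqr : IsWeakerOn R q r) : IsWeakerOn R p r := by
  obtain ⟨K, hK, hpq⟩ := hpq
  obtain ⟨L, hL, hqr⟩ := hqr
  refine ⟨K * L, mul_nonneg hK hL, fun s f hf => (hpq s f hf).trans ?_⟩
  rw [mul_assoc]
  gcongr
  exact hqr s f hf

theorem isWeakerOn_pderiv {R : ℝ} (hR : 0 ≤ R) (j : Fin n) (p : MvPolynomial (Fin n) ℂ) :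
    IsWeakerOn R (pderiv j p) p := by
  refine ⟨2 * ↑(p.totalDegree + 1) * R, by positivity, fun s f hf => ?_⟩
  rw [← pderiv_translate]
  refine norm_diffOp_pderiv_le hR j _ ?_ hf
  have hsemiconj : Function.Semiconj (translate s) (pderiv j) (pderiv j) :=
    fun q => (pderiv_translate s j q).symm
  rw [← hsemiconj.iterate_right _ p, iterate_pderiv_eq_zero j (Nat.lt_succ_self _), map_zero]

theorem IsWeakerOn.exists_norm_diffOp_le {R : ℝ} {p q : MvPolynomial (Fin n) ℂ}
    (h : IsWeakerOn R q p) :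
    ∃ K, ∀ f : 𝓢(E n, ℂ), tsupport f ⊆ Metric.closedBall 0 R →
      ‖toL2 (diffOp q f)‖ ≤ K * ‖toL2 (diffOp p f)‖ := by
  obtain ⟨K, -, h⟩ := h
  exact ⟨K, fun f hf => by simpa only [translate_zero, AlgHom.id_apply] using h 0 f hf⟩

section Polynomial

variable {σ R : Type*} [CommSemiring R]

theorem exists_totalDegree_pderiv_eq [CharZero R] [NoZeroDivisors R] {p : MvPolynomial σ R} {d : ℕ}
    (hp : p.totalDegree = d + 1) : ∃ i, (pderiv i p).totalDegree = d := by
  have hne : p.support.Nonempty := by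
    rw [MvPolynomial.support_nonempty]
    rintro rfl
    simp at hp
  obtain ⟨α, hα, hdeg⟩ := Finset.exists_mem_eq_sup p.support hne fun s => s.sum fun _ e => e
  obtain ⟨i, hi⟩ : ∃ i, α i ≠ 0 := by
    by_contra! h
    rw [← MvPolynomial.totalDegree, hp, show α = 0 from Finsupp.ext h, Finsupp.sum_zero_index]
      at hdeg
    lia
  have hadd : α - Finsupp.single i 1 + Finsupp.single i 1 = α :=
    tsub_add_cancel_of_le (by simpa [Nat.one_le_iff_ne_zero] using hi)
  have hmem : α - Finsupp.single i 1 ∈ (pderiv i p).support := by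
    rw [MvPolynomial.mem_support_iff, MvPolynomial.coeff_pderiv, hadd]
    exact mul_ne_zero (MvPolynomial.mem_support_iff.1 hα) (Nat.cast_add_one_ne_zero _)
  have hsum : (α.sum fun _ e => e) = ((α - Finsupp.single i 1).sum fun _ e => e) + 1 := by
    conv_lhs => rw [← hadd]
    rw [Finsupp.sum_add_index' (fun _ => rfl) (fun _ _ _ => rfl), Finsupp.sum_single_index rfl]
  rw [← MvPolynomial.totalDegree, hp, hsum] at hdeg
  refine ⟨i, le_antisymm ((totalDegree_pderiv_le i p).trans (by lia)) ?_⟩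
  exact (Nat.add_right_cancel hdeg).trans_le (MvPolynomial.le_totalDegree hmem)

theorem eq_C_add_sum_of_totalDegree_le_one [Fintype σ] {p : MvPolynomial σ R}
    (hp : p.totalDegree ≤ 1) :
    p = C (p.coeff 0) + ∑ k, C (p.coeff (Finsupp.single k 1)) * X k := by
  classical
  ext m
  simp only [MvPolynomial.coeff_add, MvPolynomial.coeff_sum, MvPolynomial.coeff_C_mul,
    MvPolynomial.coeff_C, MvPolynomial.coeff_X, mul_ite, mul_one, mul_zero]
  rcases eq_or_ne m 0 with rfl | hm
  · simp
  · rw [if_neg hm.symm, zero_add]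
    by_cases hlin : ∃ j, m = Finsupp.single j 1
    · obtain ⟨j, rfl⟩ := hlin
      simp [Finsupp.single_left_inj]
    · have hterm : ∀ k, Finsupp.single k 1 ≠ m := fun k hk => hlin ⟨k, hk.symm⟩
      simp only [hterm, if_false, Finset.sum_const_zero]
      refine MvPolynomial.coeff_eq_zero_of_totalDegree_lt (hp.trans_lt ?_)
      have hdeg_zero : m.degree ≠ 0 := fun h => hm ((Finsupp.degree_eq_zero_iff m).1 h)
      have hdeg_one : m.degree ≠ 1 := fun h =>
        hlin ((Finsupp.sum_eq_one_iff m).1 h)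
      change 1 < m.degree
      lia

end Polynomial

/-- A real polynomial, viewed as a complex one. -/
abbrev complexify (P : MvPolynomial (Fin n) ℝ) : MvPolynomial (Fin n) ℂ :=
  MvPolynomial.map (algebraMap ℝ ℂ) P

theorem isWeakerOn_derivPoly {R : ℝ} (hR : 0 ≤ R) (P : MvPolynomial (Fin n) ℝ) (α : Fin n → ℕ) :
    IsWeakerOn R (complexify (derivPoly P α)) (complexify P) := by
  unfold derivPoly
  induction List.finRange n with
  | nil => exact .refl R _
  | cons j l ih =>
    rw [List.foldr_cons]
    induction α j with
    | zero => exact ih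
    | succ k ihk =>
      rw [Function.iterate_succ_apply', complexify, ← MvPolynomial.pderiv_map]
      exact (isWeakerOn_pderiv hR j _).trans ihk

theorem exists_linear_isWeakerOn {R : ℝ} (hR : 0 ≤ R) {P : MvPolynomial (Fin n) ℝ}
    (hP : 1 ≤ P.totalDegree) :
    ∃ L : MvPolynomial (Fin n) ℝ,
      L.totalDegree = 1 ∧ IsWeakerOn R (complexify L) (complexify P) := by
  obtain ⟨d, hd⟩ := Nat.exists_eq_add_of_le' hP
  induction d generalizing P with
  | zero => exact ⟨P, hd, .refl R _⟩
  | succ d ih =>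
    obtain ⟨i, hi⟩ := exists_totalDegree_pderiv_eq hd
    obtain ⟨L, hL, hweak⟩ := ih (P := pderiv i P) (by lia) hi
    rw [complexify, complexify, ← MvPolynomial.pderiv_map] at hweak
    exact ⟨L, hL, hweak.trans (isWeakerOn_pderiv hR i _)⟩

/-- The coefficients of the linear part of a polynomial. -/
def linearPart (L : MvPolynomial (Fin n) ℝ) : E n :=
  WithLp.toLp 2 fun k => L.coeff (Finsupp.single k 1)

theorem linearPart_ne_zero {L : MvPolynomial (Fin n) ℝ} (hL : L.totalDegree = 1) :
    linearPart L ≠ 0 := by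
  intro h
  have hcoeff : ∀ k, L.coeff (Finsupp.single k 1) = 0 := fun k => congr($h k)
  rw [eq_C_add_sum_of_totalDegree_le_one hL.le] at hL
  simp [hcoeff] at hL

theorem im_multiplier_translate {L : MvPolynomial (Fin n) ℝ} (hL : L.totalDegree ≤ 1)
    (η ξ : E n) :
    (multiplier (translate (fun k => Complex.I * η k) (complexify L)) ξ).im =
      inner ℝ (linearPart L) η := by
  rw [multiplier, eval_translate, complexify]
  conv_lhs => rw [eq_C_add_sum_of_totalDegree_le_one hL]
  simp [PiLp.inner_apply, linearPart, mul_comm]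

theorem mul_norm_le_norm_diffOp {q : MvPolynomial (Fin n) ℂ} {c : ℝ}
    (h : ∀ ξ, c ≤ ‖multiplier q ξ‖) (f : 𝓢(E n, ℂ)) : c * ‖toL2 f‖ ≤ ‖toL2 (diffOp q f)‖ := by
  rcases le_total c 0 with hc | hc
  · exact (mul_nonpos_of_nonpos_of_nonneg hc (norm_nonneg _)).trans (norm_nonneg _)
  · have hle := norm_diffOp_le (p := C (c : ℂ)) (q := q) (c := 1)
      (fun ξ => by simpa [multiplier, abs_of_nonneg hc] using h ξ) f
    rwa [diffOp_C, map_smul, norm_smul, Complex.norm_real, Real.norm_of_nonneg hc, one_mul] at hle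

theorem exists_carleman_translate {R : ℝ} (hR : 0 ≤ R) {P : MvPolynomial (Fin n) ℝ}
    (hP : 1 ≤ P.totalDegree) :
    ∃ a : E n, a ≠ 0 ∧ ∀ (η : E n) (f : 𝓢(E n, ℂ)), tsupport f ⊆ Metric.closedBall 0 R →
      |inner ℝ a η| * ‖toL2 f‖ ≤
        ‖toL2 (diffOp (translate (fun k => Complex.I * η k) (complexify P)) f)‖ := by
  obtain ⟨L, hL, K, hK, hweak⟩ := exists_linear_isWeakerOn hR hP
  have hK1 : (0 : ℝ) < K + 1 := by positivity
  refine ⟨(K + 1)⁻¹ • linearPart L,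
    smul_ne_zero (inv_ne_zero hK1.ne') (linearPart_ne_zero hL), fun η f hf => ?_⟩
  rw [real_inner_smul_left, abs_mul, abs_of_pos (inv_pos.2 hK1), mul_assoc,
    inv_mul_le_iff₀ hK1]
  calc |inner ℝ (linearPart L) η| * ‖toL2 f‖
      ≤ ‖toL2 (diffOp (translate (fun k => Complex.I * η k) (complexify L)) f)‖ := by
        refine mul_norm_le_norm_diffOp (fun ξ => ?_) f
        rw [← im_multiplier_translate hL.le η ξ]
        exact Complex.abs_im_le_norm _
    _ ≤ K * ‖toL2 (diffOp (translate (fun k => Complex.I * η k) (complexify P)) f)‖ :=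
        hweak _ f hf
    _ ≤ (K + 1) * ‖toL2 (diffOp (translate (fun k => Complex.I * η k) (complexify P)) f)‖ := by
        gcongr
        exact le_add_of_nonneg_right zero_le_one

/-- The weight `e^{⟨η, x⟩}` of the Carleman estimate. -/
def expWeight (η x : E n) : ℂ := (Real.exp (inner ℝ η x) : ℂ)

theorem contDiff_expWeight (η : E n) : ContDiff ℝ (⊤ : ℕ∞) (expWeight η) :=
  Complex.ofRealCLM.contDiff.comp (Real.contDiff_exp.comp (contDiff_const.inner ℝ contDiff_id))

theorem hasFDerivAt_expWeight (η x : E n) :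
    HasFDerivAt (expWeight η)
      (Complex.ofRealCLM.comp (Real.exp (inner ℝ η x) • innerSL ℝ η)) x :=
  Complex.ofRealCLM.hasFDerivAt.comp x (innerSL ℝ η).hasFDerivAt.exp

theorem diffOp_translate_expWeight (η : E n) (q : MvPolynomial (Fin n) ℂ) {f g : 𝓢(E n, ℂ)}
    (hfg : ⇑g = fun x => expWeight η x * f x) :
    ⇑(diffOp (translate (fun k => Complex.I * η k) q) g) =
      fun x => expWeight η x * diffOp q f x := by
  induction q using MvPolynomial.induction_on generalizing f g with
  | C a =>
    ext x
    rw [translate_C, diffOp_C, diffOp_C, smul_apply, smul_apply, hfg, smul_eq_mul, smul_eq_mul,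
      mul_left_comm]
  | add p q hp hq =>
    ext x
    simp only [map_add, add_apply, hp hfg, hq hfg, mul_add]
  | mul_X p k hp =>
    rw [map_mul, diffOp_mul_apply, diffOp_mul_apply]
    refine hp (funext fun x => ?_)
    have hprod : HasFDerivAt (fun x => expWeight η x * f x) _ x :=
      (hasFDerivAt_expWeight η x).mul (f.hasFDerivAt x)
    rw [translate_X, map_add, add_apply, diffOp_C, add_apply, smul_apply, coe_diffOp_X,
      coe_diffOp_X, D, D, hfg, hprod.fderiv]
    simp [expWeight, EuclideanSpace.inner_single_right]
    ring

theorem iterate_D (j : Fin n) (k : ℕ) (f : 𝓢(E n, ℂ)) : (D j)^[k] f = ⇑(diffOp (X j ^ k) f) := by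
  induction k with
  | zero => simp
  | succ k ih =>
    rw [Function.iterate_succ_apply', ih, ← coe_diffOp_X, ← diffOp_mul_apply, pow_succ']

theorem DPow_eq_diffOp (α : Fin n →₀ ℕ) (f : 𝓢(E n, ℂ)) :
    DPow α f = ⇑(diffOp (MvPolynomial.monomial α 1) f) := by
  have hfold (l : List (Fin n)) : l.foldr (fun j g => (D j)^[α j] g) f =
      ⇑(diffOp (l.map fun j => (X j ^ α j : MvPolynomial (Fin n) ℂ)).prod f) := by
    induction l with
    | nil => simp
    | cons j l ih =>
      rw [List.foldr_cons, ih, iterate_D, ← diffOp_mul_apply, List.map_cons, List.prod_cons]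
  rw [DPow, hfold, ← Fin.prod_univ_def, MvPolynomial.monomial_eq, MvPolynomial.C_1, one_mul,
    Finsupp.prod_fintype _ _ fun _ => pow_zero _]

theorem opD_eq_diffOp (P : MvPolynomial (Fin n) ℝ) (f : 𝓢(E n, ℂ)) :
    opD P f = ⇑(diffOp (complexify P) f) := by
  ext x
  have hsum : complexify P =
      ∑ α ∈ P.support, C ((P.coeff α : ℝ) : ℂ) * MvPolynomial.monomial α 1 := by
    conv_lhs => rw [complexify, P.as_sum, map_sum]
    simp only [MvPolynomial.map_monomial, MvPolynomial.C_mul_monomial, mul_one,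
      Complex.coe_algebraMap]
  simp only [opD, hsum, map_sum, sum_apply, diffOp_mul_apply, diffOp_C, smul_apply, smul_eq_mul,
    DPow_eq_diffOp]

theorem conjPoly_complexify (P : MvPolynomial (Fin n) ℝ) :
    conjPoly (complexify P) = complexify P := by
  ext m; simp [MvPolynomial.coeff_map]

theorem diffOp_complexify_sub_C (P : MvPolynomial (Fin n) ℝ) (lam : ℝ) (f : 𝓢(E n, ℂ)) :
    diffOp (complexify (P - C lam)) f = diffOp (complexify P) f - (lam : ℂ) • f := by
  rw [complexify, map_sub, MvPolynomial.map_C, map_sub, sub_apply, diffOp_C, Complex.coe_algebraMap]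

theorem multiplier_complexify (P : MvPolynomial (Fin n) ℝ) (ξ : E n) :
    multiplier (complexify P) ξ = symbol P ((2 * Real.pi) • ξ) := by
  have hsymbol : symbol P ((2 * Real.pi) • ξ) =
      MvPolynomial.aeval (fun j => 2 * Real.pi * ξ j) P := rfl
  rw [multiplier, MvPolynomial.eval_map, hsymbol, ← Complex.coe_algebraMap,
    ← MvPolynomial.aeval_algebraMap_apply]
  rfl

variable {Ω : TopologicalSpace.Opens (E n)}

/-- Restriction of Schwartz functions to `L²(Ω)`. -/
def restrictL2 (Ω : TopologicalSpace.Opens (E n)) : 𝓢(E n, ℂ) →L[ℂ] L2 Ω :=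
  (LpToLpRestrictCLM (E n) ℂ ℂ volume 2 (Ω : Set (E n))).comp toL2

theorem coeFn_restrictL2 (Ω : TopologicalSpace.Opens (E n)) (f : 𝓢(E n, ℂ)) :
    restrictL2 Ω f =ᵐ[volume.restrict (Ω : Set (E n))] f :=
  (LpToLpRestrictCLM_coeFn ℂ (Ω : Set (E n)) (toL2 f)).trans (ae_restrict_of_ae (coeFn_toL2 f))

theorem inner_restrictL2 {f : 𝓢(E n, ℂ)} (hf : tsupport f ⊆ Ω) (g : 𝓢(E n, ℂ)) :
    inner ℂ (restrictL2 Ω f) (restrictL2 Ω g) = inner ℂ (toL2 f) (toL2 g) := by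
  have hset : ∫ x in (Ω : Set (E n)), inner ℂ (restrictL2 Ω f x) (restrictL2 Ω g x) =
      ∫ x in (Ω : Set (E n)), inner ℂ (f x) (g x) := by
    refine integral_congr_ae ?_
    filter_upwards [coeFn_restrictL2 Ω f, coeFn_restrictL2 Ω g] with x hx hy
    rw [hx, hy]
  rw [L2.inner_def, hset, inner_toL2]
  refine setIntegral_eq_integral_of_forall_compl_eq_zero fun x hx => ?_
  rw [image_eq_zero_of_notMem_tsupport fun h => hx (hf h), inner_zero_left]

theorem norm_restrictL2 {f : 𝓢(E n, ℂ)} (hf : tsupport f ⊆ Ω) : ‖restrictL2 Ω f‖ = ‖toL2 f‖ := by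
  rw [@norm_eq_sqrt_re_inner ℂ, inner_restrictL2 hf, ← norm_eq_sqrt_re_inner]

/-- The test functions `C_0^∞(Ω)`, as a subspace of the Schwartz space. -/
def testFunctions (Ω : TopologicalSpace.Opens (E n)) : Submodule ℂ 𝓢(E n, ℂ) where
  carrier := {f | HasCompactSupport f ∧ tsupport f ⊆ Ω}
  add_mem' := fun {f g} hf hg => ⟨hf.1.add hg.1,
    (tsupport_add f g).trans (Set.union_subset hf.2 hg.2)⟩
  zero_mem' := ⟨by simp [HasCompactSupport], by simp⟩
  smul_mem' := fun a f hf => ⟨hf.1.smul_left (f := fun _ => a),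
    (tsupport_smul_subset_right (fun _ => a) f).trans hf.2⟩

theorem diffOp_mem_testFunctions (q : MvPolynomial (Fin n) ℂ) {f : 𝓢(E n, ℂ)}
    (hf : f ∈ testFunctions Ω) : diffOp q f ∈ testFunctions Ω :=
  ⟨hf.1.mono' (subset_closure.trans (tsupport_diffOp_subset q f)),
    (tsupport_diffOp_subset q f).trans hf.2⟩

/-- A test function as a Schwartz function. -/
def toSchwartz (φ : 𝓓(Ω, ℂ)) : 𝓢(E n, ℂ) := φ.hasCompactSupport.toSchwartzMap φ.contDiff

theorem toSchwartz_mem (φ : 𝓓(Ω, ℂ)) : toSchwartz φ ∈ testFunctions Ω :=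
  ⟨φ.hasCompactSupport, φ.tsupport_subset⟩

/-- The graph map `f ↦ (f, P(D) f)`. -/
def graphMap (P : MvPolynomial (Fin n) ℝ) (Ω : TopologicalSpace.Opens (E n)) :
    𝓢(E n, ℂ) →L[ℂ] L2 Ω × L2 Ω :=
  (restrictL2 Ω).prod ((restrictL2 Ω).comp (diffOp (complexify P)))

/-- The space `H_0^P(Ω)` as a closed subspace of `L²(Ω) × L²(Ω)`. -/
def H0Submodule (P : MvPolynomial (Fin n) ℝ) (Ω : TopologicalSpace.Opens (E n)) :
    Submodule ℂ (L2 Ω × L2 Ω) :=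
  ((testFunctions Ω).map (graphMap P Ω).toLinearMap).topologicalClosure

theorem coe_H0Submodule (P : MvPolynomial (Fin n) ℝ) (Ω : TopologicalSpace.Opens (E n)) :
    (H0Submodule P Ω : Set (L2 Ω × L2 Ω)) = H0 P Ω := by
  rw [H0Submodule, Submodule.topologicalClosure_coe, H0]
  congr 1
  ext p
  simp only [Submodule.map_coe, Set.mem_image, SetLike.mem_coe, Set.mem_ofPred_eq]
  constructor
  · rintro ⟨f, hf, rfl⟩
    exact ⟨⟨f, f.smooth _, hf.1, hf.2⟩, coeFn_restrictL2 Ω f,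
      (coeFn_restrictL2 Ω _).trans (.of_eq (opD_eq_diffOp P f).symm)⟩
  · rintro ⟨φ, hfst, hsnd⟩
    refine ⟨toSchwartz φ, toSchwartz_mem φ, Prod.ext (Lp.ext ?_) (Lp.ext ?_)⟩
    · exact (coeFn_restrictL2 Ω _).trans hfst.symm
    · exact (coeFn_restrictL2 Ω _).trans
        ((EventuallyEq.of_eq (opD_eq_diffOp P (toSchwartz φ)).symm).trans hsnd.symm)

variable {P : MvPolynomial (Fin n) ℝ}

theorem mem_H0Submodule {u : L2 Ω × L2 Ω} : u ∈ H0Submodule P Ω ↔ u ∈ H0 P Ω := by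
  rw [← coe_H0Submodule, SetLike.mem_coe]

theorem isClosed_H0Submodule : IsClosed (H0Submodule P Ω : Set (L2 Ω × L2 Ω)) :=
  Submodule.isClosed_topologicalClosure _

theorem graphMap_mem_H0Submodule {f : 𝓢(E n, ℂ)} (hf : f ∈ testFunctions Ω) :
    graphMap P Ω f ∈ H0Submodule P Ω :=
  Submodule.le_topologicalClosure _ ⟨f, hf, rfl⟩

@[elab_as_elim]
theorem H0Submodule_induction {p : L2 Ω × L2 Ω → Prop} (hclosed : IsClosed {u | p u})
    (htest : ∀ f ∈ testFunctions Ω, p (restrictL2 Ω f, restrictL2 Ω (diffOp (complexify P) f)))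
    (u : L2 Ω × L2 Ω) (hu : u ∈ H0Submodule P Ω) : p u := by
  refine closure_minimal (t := {u | p u}) ?_ hclosed hu
  rintro _ ⟨f, hf, rfl⟩
  exact htest f hf

theorem inner_snd_fst_eq_inner_fst_snd {u v : L2 Ω × L2 Ω} (hu : u ∈ H0Submodule P Ω)
    (hv : v ∈ H0Submodule P Ω) : inner ℂ u.2 v.1 = inner ℂ u.1 v.2 := by
  refine H0Submodule_induction (isClosed_eq (by fun_prop) (by fun_prop)) (fun g _ => ?_) v hv
  refine H0Submodule_induction (isClosed_eq (by fun_prop) (by fun_prop)) (fun f hf => ?_) u hu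
  rw [inner_restrictL2 (diffOp_mem_testFunctions _ hf).2, inner_restrictL2 hf.2,
    inner_diffOp_left, conjPoly_complexify]

/-- The map `(u, P(D) u) ↦ (P(D) - λ) u`. -/
def shifted {H : Type*} [NormedAddCommGroup H] [NormedSpace ℂ H] (lam : ℝ) : H × H →L[ℂ] H :=
  ContinuousLinearMap.snd ℂ H H - (lam : ℂ) • ContinuousLinearMap.fst ℂ H H

theorem shifted_apply {H : Type*} [NormedAddCommGroup H] [NormedSpace ℂ H] (lam : ℝ) (u : H × H) :
    shifted lam u = u.2 - (lam : ℂ) • u.1 := rfl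

theorem shifted_restrictL2 (lam : ℝ) (f : 𝓢(E n, ℂ)) :
    shifted lam (restrictL2 Ω f, restrictL2 Ω (diffOp (complexify P) f)) =
      restrictL2 Ω (diffOp (complexify (P - C lam)) f) := by
  rw [shifted_apply, diffOp_complexify_sub_C, map_sub, map_smul]

theorem mul_norm_fst_le_norm_shifted {lam K : ℝ} (hK : ∀ ξ : E n, K ≤ |symbol P ξ - lam|)
    {u : L2 Ω × L2 Ω} (hu : u ∈ H0Submodule P Ω) : K * ‖u.1‖ ≤ ‖shifted lam u‖ := by
  refine H0Submodule_induction (isClosed_le (by fun_prop) (by fun_prop)) (fun f hf => ?_) u hu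
  rw [shifted_restrictL2, norm_restrictL2 hf.2, norm_restrictL2 (diffOp_mem_testFunctions _ hf).2]
  refine mul_norm_le_norm_diffOp (fun ξ => ?_) f
  rw [multiplier_complexify, Complex.norm_real, Real.norm_eq_abs]
  simpa [symbol] using hK ((2 * Real.pi) • ξ)

theorem exists_norm_fst_le (hΩ : Bornology.IsBounded (Ω : Set (E n))) (hP : 1 ≤ P.totalDegree) :
    ∃ K, ∀ u ∈ H0Submodule P Ω, ‖u.1‖ ≤ K * ‖u.2‖ := by
  obtain ⟨R, hR, hΩR⟩ := hΩ.subset_closedBall_lt 0 0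
  obtain ⟨L, hL, hLP⟩ := exists_linear_isWeakerOn hR.le hP
  obtain ⟨k, hk⟩ : ∃ k, linearPart L k ≠ 0 := by
    by_contra! h
    exact linearPart_ne_zero hL (PiLp.ext h)
  obtain ⟨K, hweak⟩ := ((isWeakerOn_pderiv hR.le k _).trans hLP).exists_norm_diffOp_le
  have hpderiv : pderiv k (complexify L) = C (linearPart L k : ℂ) := by
    conv_lhs => rw [complexify, eq_C_add_sum_of_totalDegree_le_one hL.le]
    simp [MvPolynomial.pderiv_X, Pi.single_apply, linearPart]
  have hpos : 0 < |linearPart L k| := abs_pos.2 hk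
  refine ⟨K / |linearPart L k|, fun u hu => ?_⟩
  rw [div_mul_eq_mul_div, le_div_iff₀' hpos]
  refine H0Submodule_induction (isClosed_le (by fun_prop) (by fun_prop)) (fun f hf => ?_) u hu
  have hle := hweak f (hf.2.trans hΩR)
  rw [hpderiv, diffOp_C, map_smul, norm_smul, Complex.norm_real, Real.norm_eq_abs] at hle
  rwa [norm_restrictL2 hf.2, norm_restrictL2 (diffOp_mem_testFunctions _ hf).2]

theorem exists_norm_le (hΩ : Bornology.IsBounded (Ω : Set (E n))) (hP : 1 ≤ P.totalDegree) :
    ∃ C, ∀ u ∈ H0Submodule P Ω, ‖u‖ ≤ C * ‖u.2‖ := by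
  obtain ⟨K, hfst⟩ := exists_norm_fst_le hΩ hP
  refine ⟨max K 1, fun u hu => ?_⟩
  rw [Prod.norm_def, max_mul_of_nonneg _ _ (norm_nonneg _), one_mul]
  exact max_le_max_right _ (hfst u hu)

section Multiplication

variable {α : Type*} {mα : MeasurableSpace α} {μ : Measure α} {g : α → ℂ}

/-- Multiplication by an essentially bounded function on `L²`. -/
def mulL2 (hg : MemLp g ∞ μ) : Lp ℂ 2 μ →L[ℂ] Lp ℂ 2 μ :=
  (ContinuousLinearMap.mul ℂ ℂ).holderL μ ∞ 2 2 hg.toLp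

theorem coeFn_mulL2 (hg : MemLp g ∞ μ) (u : Lp ℂ 2 μ) : mulL2 hg u =ᵐ[μ] fun x => g x * u x := by
  filter_upwards [(ContinuousLinearMap.mul ℂ ℂ).coeFn_holder (r := 2) hg.toLp u, hg.coeFn_toLp]
    with x hmul hx
  rw [← hx]
  exact hmul

theorem mulL2_eq_zero_iff (hg : MemLp g ∞ μ) (hg₀ : ∀ᵐ x ∂μ, g x ≠ 0) {u : Lp ℂ 2 μ} :
    mulL2 hg u = 0 ↔ u = 0 := by
  refine ⟨fun h => (Lp.eq_zero_iff_ae_eq_zero).2 ?_, fun h => by rw [h, map_zero]⟩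
  filter_upwards [coeFn_mulL2 hg u, (Lp.eq_zero_iff_ae_eq_zero).1 h, hg₀] with x hmul hx hgx
  exact (mul_eq_zero.1 (hmul.symm.trans hx)).resolve_left hgx

end Multiplication

theorem memLp_expWeight (hΩ : Bornology.IsBounded (Ω : Set (E n))) (η : E n) :
    MemLp (expWeight η) ∞ (volume.restrict (Ω : Set (E n))) := by
  obtain ⟨R, -, hΩR⟩ := hΩ.subset_closedBall_lt 0 0
  refine memLp_top_of_bound (contDiff_expWeight η).continuous.aestronglyMeasurable
    (Real.exp (‖η‖ * R)) ?_
  filter_upwards [ae_restrict_mem Ω.isOpen.measurableSet] with x hx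
  rw [expWeight, Complex.norm_real, Real.norm_eq_abs, Real.abs_exp, Real.exp_le_exp]
  refine (real_inner_le_norm η x).trans ?_
  gcongr
  exact mem_closedBall_zero_iff.1 (hΩR hx)

theorem exists_expWeight_mul (η : E n) {f : 𝓢(E n, ℂ)} (hf : f ∈ testFunctions Ω) :
    ∃ g ∈ testFunctions Ω, ⇑g = fun x => expWeight η x * f x := by
  have hcompact : HasCompactSupport fun x => expWeight η x * f x := hf.1.mul_left
  exact ⟨hcompact.toSchwartzMap ((contDiff_expWeight η).mul (f.smooth _)),
    ⟨hcompact, (tsupport_mul_subset_right (f := expWeight η)).trans hf.2⟩, rfl⟩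

theorem mulL2_expWeight_restrictL2 (hΩ : Bornology.IsBounded (Ω : Set (E n))) (η : E n)
    {f g : 𝓢(E n, ℂ)} (hfg : ⇑g = fun x => expWeight η x * f x) :
    mulL2 (memLp_expWeight hΩ η) (restrictL2 Ω f) = restrictL2 Ω g := by
  refine Lp.ext ((coeFn_mulL2 _ _).trans ?_)
  filter_upwards [coeFn_restrictL2 Ω f, coeFn_restrictL2 Ω g] with x hx hy
  rw [hx, hy, hfg]

theorem one_le_totalDegree_sub_C (hP : 1 ≤ P.totalDegree) (lam : ℝ) :
    1 ≤ (P - C lam).totalDegree := by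
  by_contra! h
  have hconst := MvPolynomial.totalDegree_eq_zero_iff_eq_C.1 (Nat.lt_one_iff.1 h)
  rw [sub_eq_iff_eq_add.1 hconst, ← map_add, MvPolynomial.totalDegree_C] at hP
  exact Nat.not_succ_le_zero 0 hP

theorem exists_carleman (hΩ : Bornology.IsBounded (Ω : Set (E n))) (hP : 1 ≤ P.totalDegree)
    (lam : ℝ) :
    ∃ a : E n, a ≠ 0 ∧ ∀ η, ∀ u ∈ H0Submodule P Ω,
      |inner ℝ a η| * ‖mulL2 (memLp_expWeight hΩ η) u.1‖ ≤
        ‖mulL2 (memLp_expWeight hΩ η) (shifted lam u)‖ := by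
  obtain ⟨R, hR, hΩR⟩ := hΩ.subset_closedBall_lt 0 0
  obtain ⟨a, ha, hcarleman⟩ := exists_carleman_translate hR.le (one_le_totalDegree_sub_C hP lam)
  refine ⟨a, ha, fun η u hu => ?_⟩
  refine H0Submodule_induction (isClosed_le (by fun_prop) (by fun_prop)) (fun f hf => ?_) u hu
  obtain ⟨g, hg, hgf⟩ := exists_expWeight_mul η hf
  rw [shifted_restrictL2, mulL2_expWeight_restrictL2 hΩ η hgf,
    mulL2_expWeight_restrictL2 hΩ η (diffOp_translate_expWeight η _ hgf),
    norm_restrictL2 hg.2, norm_restrictL2 (diffOp_mem_testFunctions _ hg).2]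
  exact hcarleman η g (hg.2.trans hΩR)

theorem fst_eq_zero_of_norm_shifted_le (hΩ : Bornology.IsBounded (Ω : Set (E n)))
    (hP : 1 ≤ P.totalDegree) {lam M : ℝ} (hM : 0 ≤ M) {u : L2 Ω × L2 Ω} (hu : u ∈ H0Submodule P Ω)
    (hle : ∀ᵐ x ∂volume.restrict (Ω : Set (E n)), ‖shifted lam u x‖ ≤ M * ‖u.1 x‖) : u.1 = 0 := by
  obtain ⟨a, ha, hcarleman⟩ := exists_carleman hΩ hP lam
  set η := ((M + 1) / ‖a‖ ^ 2) • a
  have hη : |inner ℝ a η| = M + 1 := by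
    rw [real_inner_smul_right, real_inner_self_eq_norm_sq,
      div_mul_cancel₀ _ (pow_ne_zero 2 (norm_ne_zero_iff.2 ha)), abs_of_pos (by positivity)]
  have hlower := hcarleman η u hu
  have hupper : ‖mulL2 (memLp_expWeight hΩ η) (shifted lam u)‖ ≤
      M * ‖mulL2 (memLp_expWeight hΩ η) u.1‖ := by
    refine Lp.norm_le_mul_norm_of_ae_le_mul ?_
    filter_upwards [hle, coeFn_mulL2 (memLp_expWeight hΩ η) (shifted lam u),
      coeFn_mulL2 (memLp_expWeight hΩ η) u.1] with x hx hshift hfst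
    rw [hshift, hfst, norm_mul, norm_mul, mul_left_comm]
    gcongr
  have hzero : mulL2 (memLp_expWeight hΩ η) u.1 = 0 := by
    rw [← norm_le_zero_iff]
    rw [hη] at hlower
    linarith
  exact (mulL2_eq_zero_iff _ (.of_forall fun x => Complex.ofReal_ne_zero.2 (Real.exp_ne_zero _))).1
    hzero

theorem eq_zero_of_norm_shifted_le (hΩ : Bornology.IsBounded (Ω : Set (E n)))
    (hP : 1 ≤ P.totalDegree) {lam M : ℝ} (hM : 0 ≤ M) {u : L2 Ω × L2 Ω} (hu : u ∈ H0Submodule P Ω)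
    (hle : ∀ᵐ x ∂volume.restrict (Ω : Set (E n)), ‖shifted lam u x‖ ≤ M * ‖u.1 x‖) : u = 0 := by
  have hfst := fst_eq_zero_of_norm_shifted_le hΩ hP hM hu hle
  have hshift : ‖shifted lam u‖ ≤ M * ‖u.1‖ := Lp.norm_le_mul_norm_of_ae_le_mul hle
  rw [shifted_apply, hfst, smul_zero, sub_zero, norm_zero, mul_zero, norm_le_zero_iff] at hshift
  exact Prod.ext hfst hshift

theorem sq_symbolTilde (P : MvPolynomial (Fin n) ℝ) (ξ : E n) :
    symbolTilde P ξ ^ 2 = ∑ α : Fin n → Fin (P.totalDegree + 1),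
      symbol (derivPoly P fun j => α j) ξ ^ 2 :=
  Real.sq_sqrt (Finset.sum_nonneg fun _ _ => sq_nonneg _)

theorem integrable_norm_sq (f : 𝓢(E n, ℂ)) : Integrable fun x => ‖f x‖ ^ 2 :=
  (memLp_two_iff_integrable_sq_norm f.continuous.aestronglyMeasurable).1 (f.memLp 2 volume)

theorem integral_norm_fourier_sq (f : 𝓢(E n, ℂ)) : ∫ ξ, ‖𝓕 f ξ‖ ^ 2 = ‖toL2 f‖ ^ 2 := by
  rw [← norm_toL2_fourier, norm_toL2_sq]

theorem symbolTilde_sq_mul_norm_fourier_sq (f : 𝓢(E n, ℂ)) (ξ : E n) :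
    symbolTilde P ((2 * Real.pi) • ξ) ^ 2 * ‖𝓕 f ξ‖ ^ 2 =
      ∑ α : Fin n → Fin (P.totalDegree + 1),
        ‖𝓕 (diffOp (complexify (derivPoly P fun j => α j)) f) ξ‖ ^ 2 := by
  simp only [sq_symbolTilde, Finset.sum_mul, fourier_diffOp_apply, multiplier_complexify, norm_mul,
    mul_pow, Complex.norm_real, Real.norm_eq_abs, sq_abs]

theorem integrable_symbolTilde_sq_mul (P : MvPolynomial (Fin n) ℝ) (f : 𝓢(E n, ℂ)) :
    Integrable fun ξ => symbolTilde P ((2 * Real.pi) • ξ) ^ 2 * ‖𝓕 f ξ‖ ^ 2 := by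
  simp only [symbolTilde_sq_mul_norm_fourier_sq]
  exact integrable_finsetSum _ fun α _ => integrable_norm_sq (𝓕 _)

theorem exists_integral_symbolTilde_sq_mul_le {R : ℝ} (hR : 0 ≤ R) (P : MvPolynomial (Fin n) ℝ) :
    ∃ A > 0, ∀ f : 𝓢(E n, ℂ), tsupport f ⊆ Metric.closedBall 0 R →
      ∫ ξ, symbolTilde P ((2 * Real.pi) • ξ) ^ 2 * ‖𝓕 f ξ‖ ^ 2 ≤
        A * ‖toL2 (diffOp (complexify P) f)‖ ^ 2 := by
  choose K hK using fun α : Fin n → Fin (P.totalDegree + 1) =>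
    (isWeakerOn_derivPoly hR P fun j => α j).exists_norm_diffOp_le
  refine ⟨∑ α, K α ^ 2 + 1, by positivity, fun f hf => ?_⟩
  simp only [symbolTilde_sq_mul_norm_fourier_sq]
  rw [integral_finsetSum _ fun α _ => integrable_norm_sq (𝓕 _)]
  simp only [integral_norm_fourier_sq]
  rw [add_mul, Finset.sum_mul]
  refine le_add_of_le_of_nonneg (Finset.sum_le_sum fun α _ => ?_) (by positivity)
  rw [← mul_pow]
  gcongr
  exact hK α f hf

theorem tendsto_symbolTilde_smul (hP : Tendsto (symbolTilde P) (cocompact (E n)) atTop) :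
    Tendsto (fun ξ => symbolTilde P ((2 * Real.pi) • ξ) ^ 2) (cocompact (E n)) atTop :=
  (tendsto_pow_atTop two_ne_zero).comp <| hP.comp
    (Homeomorph.smulOfNeZero (2 * Real.pi) (by positivity)).isClosedEmbedding.tendsto_cocompact

theorem exists_norm_sq_le_setIntegral_add {R ε : ℝ} (hR : 0 ≤ R) (hε : 0 < ε)
    (hP : Tendsto (symbolTilde P) (cocompact (E n)) atTop) :
    ∃ r : ℝ, ∀ f : 𝓢(E n, ℂ), tsupport f ⊆ Metric.closedBall 0 R →
      ‖toL2 f‖ ^ 2 ≤ (∫ ξ in Metric.closedBall 0 r, ‖𝓕 f ξ‖ ^ 2) +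
        ε * ‖toL2 (diffOp (complexify P) f)‖ ^ 2 := by
  obtain ⟨A, hA, hAP⟩ := exists_integral_symbolTilde_sq_mul_le hR P
  obtain ⟨r, hr⟩ := Metric.closedBall_compl_subset_of_mem_cocompact
    ((tendsto_symbolTilde_smul hP).eventually_ge_atTop (A / ε)) 0
  refine ⟨r, fun f hf => ?_⟩
  have hcompl : MeasurableSet (Metric.closedBall (0 : E n) r) :=
    Metric.isClosed_closedBall.measurableSet
  have htail : ∫ ξ in (Metric.closedBall (0 : E n) r)ᶜ, ‖𝓕 f ξ‖ ^ 2 ≤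
      ε * ‖toL2 (diffOp (complexify P) f)‖ ^ 2 :=
    calc ∫ ξ in (Metric.closedBall (0 : E n) r)ᶜ, ‖𝓕 f ξ‖ ^ 2
        ≤ ∫ ξ in (Metric.closedBall (0 : E n) r)ᶜ,
            ε / A * (symbolTilde P ((2 * Real.pi) • ξ) ^ 2 * ‖𝓕 f ξ‖ ^ 2) := by
          refine setIntegral_mono_on (integrable_norm_sq (𝓕 f)).integrableOn
            ((integrable_symbolTilde_sq_mul P f).const_mul _).integrableOn hcompl.compl
            fun ξ hξ => ?_
          rw [← mul_assoc]
          refine le_mul_of_one_le_left (sq_nonneg _) ?_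
          rw [← div_le_iff₀' (by positivity), one_div_div]
          exact hr hξ
      _ ≤ ∫ ξ, ε / A * (symbolTilde P ((2 * Real.pi) • ξ) ^ 2 * ‖𝓕 f ξ‖ ^ 2) :=
          setIntegral_le_integral ((integrable_symbolTilde_sq_mul P f).const_mul _)
            (.of_forall fun ξ => by positivity)
      _ ≤ ε / A * (A * ‖toL2 (diffOp (complexify P) f)‖ ^ 2) := by
          rw [integral_const_mul]
          gcongr
          exact hAP f hf
      _ = ε * ‖toL2 (diffOp (complexify P) f)‖ ^ 2 := by field_simp
  rw [← integral_norm_fourier_sq f, ← integral_add_compl hcompl (integrable_norm_sq (𝓕 f))]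
  gcongr

theorem isFiniteMeasure_restrict {s : Set (E n)} (hs : Bornology.IsBounded s) :
    IsFiniteMeasure (volume.restrict s) :=
  ⟨by rw [Measure.restrict_apply_univ]; exact hs.measure_lt_top⟩

theorem memLp_character (hΩ : Bornology.IsBounded (Ω : Set (E n))) (ξ : E n) :
    MemLp (fun x : E n => (Real.fourierChar (inner ℝ x ξ) : ℂ)) 2
      (volume.restrict (Ω : Set (E n))) := by
  have := isFiniteMeasure_restrict hΩ
  have hcont : Continuous fun x : E n => (Real.fourierChar (inner ℝ x ξ) : ℂ) := by fun_prop
  exact .of_bound hcont.aestronglyMeasurable 1 (.of_forall fun x => (Circle.norm_coe _).le)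

/-- The character `x ↦ e^{2πi⟨x, ξ⟩}` as an element of `L²(Ω)`, so that pairing with it evaluates
the Fourier transform at `ξ`. -/
def character (hΩ : Bornology.IsBounded (Ω : Set (E n))) (ξ : E n) : L2 Ω :=
  (memLp_character hΩ ξ).toLp

section Character

variable (hΩ : Bornology.IsBounded (Ω : Set (E n)))

theorem norm_character_le (ξ : E n) : ‖character hΩ ξ‖ ≤ ‖character hΩ 0‖ := by
  refine Lp.norm_le_norm_of_ae_le ?_
  filter_upwards [(memLp_character hΩ ξ).coeFn_toLp, (memLp_character hΩ 0).coeFn_toLp]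
    with x hx hy
  rw [character, character, hx, hy, Circle.norm_coe, Circle.norm_coe]

theorem inner_character (ξ : E n) (u : L2 Ω) :
    inner ℂ (character hΩ ξ) u = VectorFourier.fourierIntegral Real.fourierChar
      (volume.restrict (Ω : Set (E n))) (innerₗ (E n)) u ξ := by
  rw [L2.inner_def]
  refine integral_congr_ae ?_
  filter_upwards [(memLp_character hΩ ξ).coeFn_toLp] with x hx
  rw [character, hx, RCLike.inner_apply, Circle.smul_def, smul_eq_mul, mul_comm, innerₗ_apply_apply,
    Real.fourierChar.map_neg_eq_inv, Circle.coe_inv_eq_conj]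

theorem continuous_inner_character (u : L2 Ω) :
    Continuous fun ξ => inner ℂ (character hΩ ξ) u := by
  have := isFiniteMeasure_restrict hΩ
  simp only [inner_character]
  exact VectorFourier.fourierIntegral_continuous Real.continuous_fourierChar continuous_inner
    ((Lp.memLp u).integrable one_le_two)

theorem inner_character_restrictL2 {f : 𝓢(E n, ℂ)} (hf : tsupport f ⊆ Ω) (ξ : E n) :
    inner ℂ (character hΩ ξ) (restrictL2 Ω f) = 𝓕 f ξ := by
  rw [inner_character, fourier_coe, Real.fourier_eq]
  rw [← setIntegral_eq_integral_of_forall_compl_eq_zero (s := (Ω : Set (E n)))]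
  · refine integral_congr_ae ?_
    filter_upwards [coeFn_restrictL2 Ω f] with x hx
    rw [hx, innerₗ_apply_apply]
  · intro x hx
    rw [image_eq_zero_of_notMem_tsupport fun h => hx (hf h), smul_zero]

theorem tendsto_setIntegral_norm_inner_character_sq {ι : Type*} {l : Filter ι}
    [l.IsCountablyGenerated] {u : ι → L2 Ω} {v : L2 Ω} {M : ℝ} (hM : ∀ᶠ i in l, ‖u i‖ ≤ M)
    (hu : ∀ y, Tendsto (fun i => inner ℂ y (u i)) l (𝓝 (inner ℂ y v))) (r : ℝ) :
    Tendsto (fun i => ∫ ξ in Metric.closedBall 0 r, ‖inner ℂ (character hΩ ξ) (u i)‖ ^ 2) l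
      (𝓝 (∫ ξ in Metric.closedBall 0 r, ‖inner ℂ (character hΩ ξ) v‖ ^ 2)) := by
  have : IsFiniteMeasure (volume.restrict (Metric.closedBall (0 : E n) r)) :=
    isFiniteMeasure_restrict Metric.isBounded_closedBall
  refine tendsto_integral_filter_of_dominated_convergence
    (fun _ => (‖character hΩ 0‖ * M) ^ 2) (.of_forall fun i => ?_) ?_ (integrable_const _)
    (.of_forall fun ξ => (hu _).norm.pow 2)
  · exact ((continuous_inner_character hΩ (u i)).norm.pow 2).aestronglyMeasurable
  · filter_upwards [hM] with i hi
    refine .of_forall fun ξ => ?_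
    rw [Real.norm_of_nonneg (sq_nonneg _)]
    gcongr
    exact (norm_inner_le_norm _ _).trans (by gcongr; exact norm_character_le hΩ ξ)

theorem exists_norm_fst_sq_le (hP : Tendsto (symbolTilde P) (cocompact (E n)) atTop) {ε : ℝ}
    (hε : 0 < ε) :
    ∃ r : ℝ, ∀ u ∈ H0Submodule P Ω, ‖u.1‖ ^ 2 ≤
      (∫ ξ in Metric.closedBall 0 r, ‖inner ℂ (character hΩ ξ) u.1‖ ^ 2) + ε * ‖u.2‖ ^ 2 := by
  obtain ⟨R, hR, hΩR⟩ := hΩ.subset_closedBall_lt 0 0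
  obtain ⟨r, hr⟩ := exists_norm_sq_le_setIntegral_add hR.le hε hP
  refine ⟨r, fun u hu => ?_⟩
  have hcont : Continuous fun v : L2 Ω =>
      ∫ ξ in Metric.closedBall 0 r, ‖inner ℂ (character hΩ ξ) v‖ ^ 2 := by
    refine continuous_iff_continuousAt.2 fun v => ?_
    refine tendsto_setIntegral_norm_inner_character_sq hΩ (M := ‖v‖ + 1) ?_
      (fun y => (continuous_const.inner continuous_id).tendsto v) r
    exact continuous_norm.continuousAt.eventually_le_const (lt_add_one _)
  refine H0Submodule_induction
    (isClosed_le (by fun_prop) ((hcont.comp continuous_fst).add (by fun_prop)))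
    (fun f hf => ?_) u hu
  simp only [inner_character_restrictL2 hΩ hf.2]
  rw [norm_restrictL2 hf.2, norm_restrictL2 (diffOp_mem_testFunctions _ hf).2]
  exact hr f (hf.2.trans hΩR)

end Character

theorem exists_subseq_tendsto_inner {H : Type*} [NormedAddCommGroup H] [InnerProductSpace ℂ H]
    [CompleteSpace H] [TopologicalSpace.SeparableSpace H] {x : ℕ → H} {M : ℝ}
    (hM : ∀ k, ‖x k‖ ≤ M) :
    ∃ φ : ℕ → ℕ, StrictMono φ ∧
      ∃ v, ∀ y, Tendsto (fun k => inner ℂ y (x (φ k))) atTop (𝓝 (inner ℂ y v)) := by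
  obtain ⟨a, -, φ, hφ, hlim⟩ := WeakDual.isSeqCompact_closedBall ℂ H 0 M
    (x := fun k => StrongDual.toWeakDual (InnerProductSpace.toDual ℂ H (x k)))
    (fun k => by simpa using hM k)
  refine ⟨φ, hφ, (InnerProductSpace.toDual ℂ H).symm (WeakDual.toStrongDual a), fun y => ?_⟩
  have heval := ((WeakDual.eval_continuous y).tendsto a).comp hlim
  have hconj := (Complex.continuous_conj.tendsto _).comp heval
  rw [← inner_conj_symm y, InnerProductSpace.toDual_symm_apply]
  refine hconj.congr fun k => ?_
  simp

theorem exists_subseq_cauchySeq_fst (hΩ : Bornology.IsBounded (Ω : Set (E n)))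
    (hP : Tendsto (symbolTilde P) (cocompact (E n)) atTop) {u : ℕ → L2 Ω × L2 Ω}
    (hu : ∀ k, u k ∈ H0Submodule P Ω) {M : ℝ} (hM : ∀ k, ‖u k‖ ≤ M) :
    ∃ φ : ℕ → ℕ, StrictMono φ ∧ CauchySeq fun k => (u (φ k)).1 := by
  have : Fact ((2 : ℝ≥0∞) ≠ ∞) := ⟨by norm_num⟩
  obtain ⟨φ, hφ, v, hv⟩ := exists_subseq_tendsto_inner fun k => (norm_fst_le (u k)).trans (hM k)
  refine ⟨φ, hφ, cauchySeq_iff_tendsto_dist_atTop_0.2 ?_⟩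
  set d : ℕ × ℕ → L2 Ω × L2 Ω := fun p => u (φ p.1) - u (φ p.2)
  have hd_weak (y : L2 Ω) : Tendsto (fun p => inner ℂ y (d p).1) atTop (𝓝 (inner ℂ y 0)) := by
    rw [← sub_self v, inner_sub_right, ← prod_atTop_atTop_eq]
    exact (((hv y).comp tendsto_fst).sub ((hv y).comp tendsto_snd)).congr
      fun p => (inner_sub_right _ _ _).symm
  have hd (p) : ‖d p‖ ≤ M + M := (norm_sub_le _ _).trans (add_le_add (hM _) (hM _))
  have hsq : Tendsto (fun p => ‖(d p).1‖ ^ 2) atTop (𝓝 0) := by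
    refine tendsto_order.2 ⟨fun a ha => .of_forall fun p => ha.trans_le (sq_nonneg _),
      fun ε hε => ?_⟩
    obtain ⟨r, hr⟩ := exists_norm_fst_sq_le hΩ hP (ε := ε / ((M + M) ^ 2 + 1)) (by positivity)
    have hmass := tendsto_setIntegral_norm_inner_character_sq hΩ
      (.of_forall fun p => (norm_fst_le _).trans (hd p)) hd_weak r
    have hsmall : ε / ((M + M) ^ 2 + 1) * (M + M) ^ 2 < ε := by
      rw [div_mul_eq_mul_div, div_lt_iff₀ (by positivity)]
      gcongr
      exact lt_add_one _
    simp only [inner_zero_right, norm_zero, ne_eq, OfNat.ofNat_ne_zero, not_false_eq_true,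
      zero_pow, integral_zero] at hmass
    filter_upwards [hmass.eventually_lt_const (sub_pos.2 hsmall)] with p hp
    calc ‖(d p).1‖ ^ 2
        ≤ _ + ε / ((M + M) ^ 2 + 1) * ‖(d p).2‖ ^ 2 := hr (d p) (sub_mem (hu _) (hu _))
      _ ≤ _ + ε / ((M + M) ^ 2 + 1) * (M + M) ^ 2 := by gcongr; exact (norm_snd_le _).trans (hd p)
      _ < ε := by linarith
  have hnorm := hsq.sqrt
  simp only [Real.sqrt_sq (norm_nonneg _), Real.sqrt_zero] at hnorm
  exact hnorm.congr fun p => (dist_eq_norm _ _).symm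

section Form

variable {H : Type*} [NormedAddCommGroup H] [InnerProductSpace ℂ H]

/-- The sesquilinear form `⟨v, (P - λ)u⟩ + ⟨(P - λ)v, T (P - λ)u⟩` on pairs `u = (u, Pu)` and
`v = (v, Pv)`. It is `B_λ(u, v)` when `T` is the multiplication by `1/V`; as for `inner`, the first
argument is the antilinear one. -/
def form (T : H →L[ℂ] H) (lam : ℝ) : H × H →L⋆[ℂ] H × H →L[ℂ] ℂ :=
  (innerSL ℂ).bilinearComp (.fst ℂ H H) (shifted lam) +
    (innerSL ℂ).bilinearComp (shifted lam) (T ∘L shifted lam)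

theorem form_apply (T : H →L[ℂ] H) (lam : ℝ) (v u : H × H) :
    form T lam v u =
      inner ℂ v.1 (shifted lam u) + inner ℂ (shifted lam v) (T (shifted lam u)) :=
  rfl

/-- The quadratic form of `form`, whose values are real on the vectors considered here. -/
def qform (T : H →L[ℂ] H) (lam : ℝ) (u : H × H) : ℝ :=
  (form T lam u u).re

/-- The `λ` for which the quadratic form of `form T λ` on `S` is bounded below by a positive
multiple of `‖Pu‖²`. -/
def coercivityPoints (T : H →L[ℂ] H) (S : Submodule ℂ (H × H)) : Set ℝ :=
  {lam | ∃ c > 0, ∀ u ∈ S, c * ‖u.2‖ ^ 2 ≤ qform T lam u}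

variable {T : H →L[ℂ] H} {lam : ℝ} {S : Submodule ℂ (H × H)}

theorem continuous_qform : Continuous (qform T lam) := by
  unfold qform
  fun_prop

theorem qform_real_smul (a : ℝ) (u : H × H) :
    qform T lam ((a : ℂ) • u) = a ^ 2 * qform T lam u := by
  simp only [qform, map_smul, map_smulₛₗ, smul_apply, Complex.conj_ofReal, smul_eq_mul,
    Complex.re_ofReal_mul]
  ring

theorem qform_parallelogram (u v : H × H) :
    qform T lam (u + v) + qform T lam (u - v) = 2 * (qform T lam u + qform T lam v) := by
  simp only [qform, map_add, map_sub, add_apply, sub_apply, Complex.add_re, Complex.sub_re]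
  ring

theorem inner_shifted_fst {u v : H × H} (huv : inner ℂ u.2 v.1 = inner ℂ u.1 v.2) (lam : ℝ) :
    inner ℂ (shifted lam u) v.1 = inner ℂ u.1 (shifted lam v) := by
  rw [shifted_apply, shifted_apply, inner_sub_left, inner_sub_right, inner_smul_left,
    inner_smul_right, huv, Complex.conj_ofReal]

theorem conj_form (hT : T.IsSymmetric) {u v : H × H}
    (huv : inner ℂ u.2 v.1 = inner ℂ u.1 v.2) : conj (form T lam u v) = form T lam v u := by
  rw [form_apply, form_apply, ← inner_shifted_fst huv, map_add, inner_conj_symm, inner_conj_symm]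
  exact congrArg _ (hT _ _)

theorem qform_sub_qform (mu : ℝ) (u : H × H) :
    qform T mu u - qform T lam u =
      (mu - lam) * ((mu + lam) * (inner ℂ u.1 (T u.1)).re -
        ((inner ℂ u.1 u.1).re + (inner ℂ u.1 (T u.2)).re + (inner ℂ u.2 (T u.1)).re)) := by
  simp only [qform, form_apply, shifted_apply, map_sub, map_smul, inner_sub_left, inner_sub_right,
    inner_smul_left, inner_smul_right, Complex.conj_ofReal, Complex.add_re, Complex.sub_re,
    Complex.re_ofReal_mul]
  ring

theorem abs_qform_sub_qform_le (mu : ℝ) (u : H × H) :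
    |qform T mu u - qform T lam u| ≤
      |mu - lam| * (|mu + lam| * ‖T‖ + (1 + ‖T‖ + ‖T‖)) * ‖u‖ ^ 2 := by
  have hinner {x y : H} {K : ℝ} (hx : ‖x‖ ≤ ‖u‖) (hy : ‖y‖ ≤ K * ‖u‖) :
      |(inner ℂ x y).re| ≤ K * ‖u‖ ^ 2 :=
    calc |(inner ℂ x y).re| ≤ ‖x‖ * ‖y‖ := (Complex.abs_re_le_norm _).trans (norm_inner_le_norm _ _)
      _ ≤ ‖u‖ * (K * ‖u‖) := by gcongr
      _ = K * ‖u‖ ^ 2 := by ring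
  have hfst := norm_fst_le u
  have hTfst : ‖T u.1‖ ≤ ‖T‖ * ‖u‖ := T.le_opNorm_of_le hfst
  have hTsnd : ‖T u.2‖ ≤ ‖T‖ * ‖u‖ := T.le_opNorm_of_le (norm_snd_le u)
  have hsquare : |(mu + lam) * (inner ℂ u.1 (T u.1)).re| ≤ |mu + lam| * ‖T‖ * ‖u‖ ^ 2 := by
    rw [abs_mul, mul_assoc]
    gcongr
    exact hinner hfst hTfst
  have hlinear : |(inner ℂ u.1 u.1).re + (inner ℂ u.1 (T u.2)).re + (inner ℂ u.2 (T u.1)).re| ≤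
      (1 + ‖T‖ + ‖T‖) * ‖u‖ ^ 2 := by
    rw [add_mul, add_mul]
    exact (abs_add_three _ _ _).trans <| add_le_add_three
      (hinner hfst (hfst.trans_eq (one_mul _).symm)) (hinner hfst hTsnd)
      (hinner (norm_snd_le u) hTfst)
  rw [qform_sub_qform, abs_mul, mul_assoc]
  gcongr
  exact (abs_sub _ _).trans ((add_le_add hsquare hlinear).trans_eq (add_mul _ _ _).symm)

theorem isOpen_coercivityPoints {C : ℝ} (hC : ∀ u ∈ S, ‖u‖ ≤ C * ‖u.2‖) :
    IsOpen (coercivityPoints T S) := by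
  refine isOpen_iff_mem_nhds.2 fun lam ⟨c, hc, hcoer⟩ => ?_
  have hsmall : Tendsto
      (fun mu => |mu - lam| * (|mu + lam| * ‖T‖ + (1 + ‖T‖ + ‖T‖)) * C ^ 2) (𝓝 lam) (𝓝 0) := by
    refine Continuous.tendsto' (by fun_prop) _ _ ?_
    rw [sub_self, abs_zero, zero_mul, zero_mul]
  filter_upwards [hsmall.eventually_le_const (half_pos hc)] with mu hmu
  refine ⟨c / 2, half_pos hc, fun u hu => ?_⟩
  have hdiff : |qform T mu u - qform T lam u| ≤ c / 2 * ‖u.2‖ ^ 2 :=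
    calc |qform T mu u - qform T lam u|
        ≤ |mu - lam| * (|mu + lam| * ‖T‖ + (1 + ‖T‖ + ‖T‖)) * ‖u‖ ^ 2 := abs_qform_sub_qform_le _ _
      _ ≤ |mu - lam| * (|mu + lam| * ‖T‖ + (1 + ‖T‖ + ‖T‖)) * (C * ‖u.2‖) ^ 2 := by
          gcongr
          exact hC u hu
      _ ≤ c / 2 * ‖u.2‖ ^ 2 := by
          rw [mul_pow, ← mul_assoc]
          gcongr
  linarith [(abs_le.1 hdiff).1, hcoer u hu]

theorem norm_snd_le_norm_shifted_add (lam : ℝ) (u : H × H) :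
    ‖u.2‖ ≤ ‖shifted lam u‖ + |lam| * ‖u.1‖ := by
  calc ‖u.2‖ = ‖shifted lam u + (lam : ℂ) • u.1‖ := by rw [shifted_apply, sub_add_cancel]
    _ ≤ ‖shifted lam u‖ + ‖(lam : ℂ) • u.1‖ := norm_add_le _ _
    _ = ‖shifted lam u‖ + |lam| * ‖u.1‖ := by rw [norm_smul, Complex.norm_real, Real.norm_eq_abs]

theorem mul_norm_shifted_sq_sub_le_qform {κ : ℝ} (hT : ∀ x, κ * ‖x‖ ^ 2 ≤ (inner ℂ x (T x)).re)
    (u : H × H) : κ * ‖shifted lam u‖ ^ 2 - ‖u.1‖ * ‖shifted lam u‖ ≤ qform T lam u := by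
  have hcross := (abs_le.1 <| (Complex.abs_re_le_norm _).trans
    (norm_inner_le_norm (𝕜 := ℂ) u.1 (shifted lam u))).1
  rw [qform, form_apply, Complex.add_re]
  linarith [hT (shifted lam u)]

theorem mem_coercivityPoints {κ K : ℝ} (hK : 0 < K) (hκ : 1 < κ * K)
    (hT : ∀ x, κ * ‖x‖ ^ 2 ≤ (inner ℂ x (T x)).re)
    (hS : ∀ u ∈ S, K * ‖u.1‖ ≤ ‖shifted lam u‖) : lam ∈ coercivityPoints T S := by
  have hgap : 0 < κ - 1 / K := by rwa [sub_pos, div_lt_iff₀ hK]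
  refine ⟨(κ - 1 / K) / (1 + |lam| / K) ^ 2, by positivity, fun u hu => ?_⟩
  have hfst : ‖u.1‖ ≤ ‖shifted lam u‖ / K := (le_div_iff₀' hK).2 (hS u hu)
  have hsnd : ‖u.2‖ ≤ (1 + |lam| / K) * ‖shifted lam u‖ :=
    calc ‖u.2‖ ≤ ‖shifted lam u‖ + |lam| * ‖u.1‖ := norm_snd_le_norm_shifted_add lam u
      _ ≤ ‖shifted lam u‖ + |lam| * (‖shifted lam u‖ / K) := by gcongr
      _ = (1 + |lam| / K) * ‖shifted lam u‖ := by ring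
  calc (κ - 1 / K) / (1 + |lam| / K) ^ 2 * ‖u.2‖ ^ 2
      ≤ (κ - 1 / K) / (1 + |lam| / K) ^ 2 * ((1 + |lam| / K) * ‖shifted lam u‖) ^ 2 := by gcongr
    _ = κ * ‖shifted lam u‖ ^ 2 - ‖shifted lam u‖ / K * ‖shifted lam u‖ := by field_simp
    _ ≤ κ * ‖shifted lam u‖ ^ 2 - ‖u.1‖ * ‖shifted lam u‖ := by gcongr
    _ ≤ qform T lam u := mul_norm_shifted_sq_sub_le_qform hT u

/-- A Gårding inequality. -/
theorem mul_norm_snd_sq_le_qform_add {κ : ℝ} (hκ : 0 < κ)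
    (hT : ∀ x, κ * ‖x‖ ^ 2 ≤ (inner ℂ x (T x)).re) (u : H × H) :
    κ / 4 * ‖u.2‖ ^ 2 ≤ qform T lam u + (κ * lam ^ 2 / 2 + 1 / (2 * κ)) * ‖u.1‖ ^ 2 := by
  have hsnd : ‖u.2‖ ^ 2 ≤ 2 * (‖shifted lam u‖ ^ 2 + lam ^ 2 * ‖u.1‖ ^ 2) :=
    calc ‖u.2‖ ^ 2 ≤ (‖shifted lam u‖ + |lam| * ‖u.1‖) ^ 2 := by
          gcongr
          exact norm_snd_le_norm_shifted_add lam u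
      _ ≤ 2 * (‖shifted lam u‖ ^ 2 + (|lam| * ‖u.1‖) ^ 2) := add_sq_le
      _ = 2 * (‖shifted lam u‖ ^ 2 + lam ^ 2 * ‖u.1‖ ^ 2) := by rw [mul_pow, sq_abs]
  have hyoung : ‖u.1‖ * ‖shifted lam u‖ ≤
      κ / 2 * ‖shifted lam u‖ ^ 2 + 1 / (2 * κ) * ‖u.1‖ ^ 2 := by
    have hsq : 0 ≤ (κ * ‖shifted lam u‖ - ‖u.1‖) ^ 2 / (2 * κ) := by positivity
    refine sub_nonneg.1 (hsq.trans_eq ?_)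
    field_simp
    ring
  have hscaled := mul_le_mul_of_nonneg_left hsnd (by positivity : 0 ≤ κ / 4)
  linarith [mul_norm_shifted_sq_sub_le_qform (lam := lam) hT u]

theorem form_eq_zero_of_qform_eq_zero (hT : T.IsSymmetric)
    (hS : ∀ u ∈ S, ∀ v ∈ S, inner ℂ u.2 v.1 = inner ℂ u.1 v.2)
    (hq : ∀ u ∈ S, 0 ≤ qform T lam u) {u v : H × H} (hu : u ∈ S) (hv : v ∈ S)
    (hu₀ : qform T lam u = 0) : form T lam v u = 0 := by
  let _ : PreInnerProductSpace.Core ℂ S :=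
    { inner := fun x y => form T lam x y
      conj_inner_symm := fun x y => conj_form hT (hS _ y.2 _ x.2)
      re_inner_nonneg := fun x => hq _ x.2
      add_left := fun x y z => by simp [map_add]
      smul_left := fun x y r => by simp }
  have hcs : ‖form T lam v u‖ * ‖form T lam u v‖ ≤ qform T lam v * qform T lam u :=
    InnerProductSpace.Core.inner_mul_inner_self_le (𝕜 := ℂ) (⟨v, hv⟩ : S) ⟨u, hu⟩
  rw [hu₀, mul_zero, ← conj_form hT (hS v hv u hu), RCLike.norm_conj, ← sq] at hcs
  exact norm_eq_zero.1 (pow_eq_zero_iff two_ne_zero |>.1 (hcs.antisymm (sq_nonneg _)))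

theorem cauchySeq_snd_of_tendsto_qform {κ : ℝ} (hκ : 0 < κ)
    (hT : ∀ x, κ * ‖x‖ ^ 2 ≤ (inner ℂ x (T x)).re) (hq : ∀ u ∈ S, 0 ≤ qform T lam u)
    {w : ℕ → H × H} (hw : ∀ k, w k ∈ S) (hfst : CauchySeq fun k => (w k).1)
    (hlim : Tendsto (fun k => qform T lam (w k)) atTop (𝓝 0)) : CauchySeq fun k => (w k).2 := by
  set K := κ * lam ^ 2 / 2 + 1 / (2 * κ)
  have hlim₁ : Tendsto (fun p : ℕ × ℕ => qform T lam (w p.1)) atTop (𝓝 0) := by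
    rw [← prod_atTop_atTop_eq]
    exact hlim.comp tendsto_fst
  have hlim₂ : Tendsto (fun p : ℕ × ℕ => qform T lam (w p.2)) atTop (𝓝 0) := by
    rw [← prod_atTop_atTop_eq]
    exact hlim.comp tendsto_snd
  have hbound (p : ℕ × ℕ) : κ / 4 * ‖(w p.1).2 - (w p.2).2‖ ^ 2 ≤
      2 * (qform T lam (w p.1) + qform T lam (w p.2)) + K * dist (w p.1).1 (w p.2).1 ^ 2 := by
    have hgarding : κ / 4 * ‖(w p.1).2 - (w p.2).2‖ ^ 2 ≤
        qform T lam (w p.1 - w p.2) + K * ‖(w p.1).1 - (w p.2).1‖ ^ 2 :=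
      mul_norm_snd_sq_le_qform_add hκ hT (w p.1 - w p.2)
    rw [dist_eq_norm]
    linarith [qform_parallelogram (T := T) (lam := lam) (w p.1) (w p.2),
      hq _ (add_mem (hw p.1) (hw p.2))]
  have hzero : Tendsto (fun p : ℕ × ℕ => κ / 4 * ‖(w p.1).2 - (w p.2).2‖ ^ 2) atTop (𝓝 0) := by
    refine squeeze_zero (fun p => by positivity) hbound ?_
    simpa using ((hlim₁.add hlim₂).const_mul 2).add
      (((cauchySeq_iff_tendsto_dist_atTop_0.1 hfst).pow 2).const_mul K)
  have hnorm := (hzero.const_mul (κ / 4)⁻¹).sqrt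
  have hcancel : (κ / 4)⁻¹ * (κ / 4) = 1 := inv_mul_cancel₀ (by positivity)
  simp only [← mul_assoc, hcancel, one_mul, mul_zero, Real.sqrt_zero,
    Real.sqrt_sq (norm_nonneg _)] at hnorm
  exact cauchySeq_iff_tendsto_dist_atTop_0.2 (hnorm.congr fun p => (dist_eq_norm _ _).symm)

theorem exists_norm_snd_eq_one_and_qform_lt (hq : ∀ u ∈ S, 0 ≤ qform T lam u)
    (hlam : lam ∉ coercivityPoints T S) {ε : ℝ} (hε : 0 < ε) :
    ∃ u ∈ S, ‖u.2‖ = 1 ∧ qform T lam u < ε := by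
  simp only [coercivityPoints, Set.mem_ofPred_eq] at hlam
  push Not at hlam
  obtain ⟨u, hu, hlt⟩ := hlam ε hε
  have hpos : 0 < ‖u.2‖ := by
    refine (norm_nonneg _).lt_of_ne fun h => (hq u hu).not_gt ?_
    rwa [← h, zero_pow two_ne_zero, mul_zero] at hlt
  refine ⟨((‖u.2‖⁻¹ : ℝ) : ℂ) • u, S.smul_mem _ hu, ?_, ?_⟩
  · rw [Prod.smul_snd, norm_smul, Complex.norm_real, norm_inv, norm_norm, inv_mul_cancel₀ hpos.ne']
  · rwa [qform_real_smul, inv_pow, inv_mul_lt_iff₀ (by positivity), mul_comm]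

theorem exists_qform_eq_zero [CompleteSpace H] (hSc : IsClosed (S : Set (H × H))) {κ : ℝ}
    (hκ : 0 < κ) (hT : ∀ x, κ * ‖x‖ ^ 2 ≤ (inner ℂ x (T x)).re)
    (hcompact : ∀ u : ℕ → H × H, (∀ k, u k ∈ S) → (∀ k, ‖(u k).2‖ ≤ 1) →
      ∃ φ : ℕ → ℕ, StrictMono φ ∧ CauchySeq fun k => (u (φ k)).1)
    (hq : ∀ u ∈ S, 0 ≤ qform T lam u) (hlam : lam ∉ coercivityPoints T S) :
    ∃ u ∈ S, u ≠ 0 ∧ qform T lam u = 0 := by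
  choose w hwS hw_snd hw_lt using fun k : ℕ =>
    exists_norm_snd_eq_one_and_qform_lt hq hlam (Nat.one_div_pos_of_nat (n := k))
  obtain ⟨φ, hφ, hfst⟩ := hcompact w hwS fun k => (hw_snd k).le
  have hlim : Tendsto (fun k => qform T lam (w (φ k))) atTop (𝓝 0) :=
    squeeze_zero (fun k => hq _ (hwS _)) (fun k => (hw_lt _).le)
      (tendsto_one_div_add_atTop_nhds_zero_nat.comp hφ.tendsto_atTop)
  have hsnd := cauchySeq_snd_of_tendsto_qform hκ hT hq (fun k => hwS (φ k)) hfst hlim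
  obtain ⟨u, hu⟩ := cauchySeq_tendsto_of_complete (hfst.prodMk hsnd)
  have hu_norm : ‖u.2‖ = 1 :=
    tendsto_nhds_unique (hu.snd_nhds.norm) (by simp only [hw_snd, tendsto_const_nhds])
  refine ⟨u, hSc.mem_of_tendsto hu (.of_forall fun k => hwS _), ?_,
    tendsto_nhds_unique ((continuous_qform.tendsto u).comp hu) hlim⟩
  rintro rfl
  exact zero_ne_one (norm_zero.symm.trans hu_norm)

theorem continuous_qform_left (u : H × H) : Continuous fun lam => qform T lam u := by
  simp only [qform, form_apply, shifted_apply]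
  fun_prop

theorem exists_uIcc_form_eq_zero [CompleteSpace H] (hSc : IsClosed (S : Set (H × H)))
    (hS : ∀ u ∈ S, ∀ v ∈ S, inner ℂ u.2 v.1 = inner ℂ u.1 v.2) {C κ : ℝ}
    (hC : ∀ u ∈ S, ‖u‖ ≤ C * ‖u.2‖) (hκ : 0 < κ) (hTsymm : T.IsSymmetric)
    (hT : ∀ x, κ * ‖x‖ ^ 2 ≤ (inner ℂ x (T x)).re)
    (hcompact : ∀ u : ℕ → H × H, (∀ k, u k ∈ S) → (∀ k, ‖(u k).2‖ ≤ 1) →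
      ∃ φ : ℕ → ℕ, StrictMono φ ∧ CauchySeq fun k => (u (φ k)).1)
    {lam₀ lam₁ : ℝ} (hlam₀ : lam₀ ∈ coercivityPoints T S) (hlam₁ : lam₁ ∉ coercivityPoints T S) :
    ∃ mu ∈ Set.uIcc lam₀ lam₁, mu ≠ lam₀ ∧ ∃ u ∈ S, u ≠ 0 ∧ ∀ v ∈ S, form T mu v u = 0 := by
  by_contra! hker
  have hclosed : IsClosed {mu | ∀ u ∈ S, 0 ≤ qform T mu u} := by
    simp only [Set.ofPred_forall]
    exact isClosed_iInter fun u => isClosed_iInter fun _ =>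
      isClosed_le continuous_const (continuous_qform_left u)
  have hsub : coercivityPoints T S ⊆ {mu | ∀ u ∈ S, 0 ≤ qform T mu u} :=
    fun mu ⟨c, hc, hcoer⟩ u hu => le_trans (by positivity) (hcoer u hu)
  refine hlam₁ (isPreconnected_uIcc.subset_of_closure_inter_subset (isOpen_coercivityPoints hC)
    ⟨lam₀, Set.left_mem_uIcc, hlam₀⟩ ?_ Set.right_mem_uIcc)
  rintro mu ⟨hmu, hmem⟩
  have hq := closure_minimal hsub hclosed hmu
  by_contra hmu_not
  obtain ⟨u, hu, hu₀, hzero⟩ := exists_qform_eq_zero hSc hκ hT hcompact hq hmu_not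
  obtain ⟨v, hv, hne⟩ := hker mu hmem (fun h => hmu_not (h ▸ hlam₀)) u hu hu₀
  exact hne (form_eq_zero_of_qform_eq_zero hTsymm hS hq hu hv hzero)

end Form

theorem D_const_mul_conj (j : Fin n) (s : ℂ) (f : E n → ℂ) :
    D j (fun x => s * conj (f x)) = fun x => -s * conj (D j f x) := by
  ext x
  have hconj : fderiv ℝ (fun x => conj (f x)) x =
      (Complex.conjCLE : ℂ →L[ℝ] ℂ).comp (fderiv ℝ f x) :=
    Complex.conjCLE.comp_fderiv
  have hfderiv : fderiv ℝ (fun x => s * conj (f x)) x = s • fderiv ℝ (fun x => conj (f x)) x :=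
    congrFun (fderiv_const_smul_field (𝕜 := ℝ) (f := fun x => conj (f x)) s) x
  simp [D, hfderiv, hconj]
  ring

theorem iterate_D_const_mul_conj (j : Fin n) (k : ℕ) (s : ℂ) (f : E n → ℂ) :
    (D j)^[k] (fun x => s * conj (f x)) = fun x => (-1) ^ k * s * conj ((D j)^[k] f x) := by
  induction k with
  | zero => simp
  | succ k ih =>
    rw [Function.iterate_succ_apply', ih, D_const_mul_conj, Function.iterate_succ_apply']
    ext x
    ring

theorem DPow_conj (α : Fin n →₀ ℕ) (f : E n → ℂ) :
    DPow α (fun x => conj (f x)) = fun x => (-1) ^ (∑ j, α j) * conj (DPow α f x) := by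
  have hfold (l : List (Fin n)) : l.foldr (fun j g => (D j)^[α j] g) (fun x => conj (f x)) =
      fun x => (-1) ^ (l.map α).sum * conj (l.foldr (fun j g => (D j)^[α j] g) f x) := by
    induction l with
    | nil => simp
    | cons j l ih =>
      rw [List.foldr_cons, ih, iterate_D_const_mul_conj, List.map_cons, List.sum_cons, pow_add,
        List.foldr_cons]
  rw [DPow, hfold, Fin.sum_univ_def]
  rfl

theorem opDTranspose_conj (P : MvPolynomial (Fin n) ℝ) (f : E n → ℂ) :
    opDTranspose P (fun x => conj (f x)) = fun x => conj (opD P f x) := by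
  ext x
  rw [opDTranspose, opD, map_sum]
  refine Finset.sum_congr rfl fun α _ => ?_
  have hsign : (-1 : ℂ) ^ (∑ j, α j) * (-1) ^ (∑ j, α j) = 1 := by
    rw [← mul_pow, neg_one_mul, neg_neg, one_pow]
  rw [DPow_conj, map_mul, Complex.conj_ofReal]
  linear_combination ((P.coeff α : ℝ) : ℂ) * conj (DPow α f x) * hsign

/-- The complex conjugate of a test function. -/
def conjTest (φ : 𝓓(Ω, ℂ)) : 𝓓(Ω, ℂ) where
  toFun := fun x => conj (φ x)
  contDiff' := Complex.conjCLE.contDiff.comp φ.contDiff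
  hasCompactSupport' := φ.hasCompactSupport.comp_left (map_zero _)
  tsupport_subset' := (tsupport_comp_subset (map_zero (starRingEnd ℂ)) φ).trans φ.tsupport_subset

/-- The bilinear pairing with test functions in `SolvesWeakly` becomes a sesquilinear pairing with
`H_0^P(Ω)`, because the symbol and `λ` are real. -/
theorem solvesWeakly_of_integral_mul_conj_eq_zero {W : E n → ℝ} {lam : ℝ} {v : E n → ℂ}
    (h : ∀ p ∈ H0Submodule P Ω, ∫ x in (Ω : Set (E n)),
      v x * conj (p.2 x + (W x : ℂ) * p.1 x - (lam : ℂ) * p.1 x) = 0) :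
    SolvesWeakly P W Ω lam v := by
  intro ψ
  set f := toSchwartz (conjTest ψ)
  rw [← h _ (graphMap_mem_H0Submodule (toSchwartz_mem (conjTest ψ)))]
  have hψ : ⇑ψ = fun x => conj (f x) := funext fun x => (Complex.conj_conj _).symm
  refine integral_congr_ae ?_
  filter_upwards [coeFn_restrictL2 Ω f, coeFn_restrictL2 Ω (diffOp (complexify P) f)]
    with x hfst hsnd
  simp only [hψ, opDTranspose_conj, opD_eq_diffOp, ← hfst, ← hsnd, graphMap,
    ContinuousLinearMap.prod_apply, ContinuousLinearMap.comp_apply, map_add, map_sub, map_mul,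
    Complex.conj_ofReal, f]

section Potential

variable {α : Type*} {mα : MeasurableSpace α} {μ : Measure α} {V g : α → ℝ}

theorem exists_ae_le (hV : MemLp V ∞ μ) : ∃ M > 0, ∀ᵐ x ∂μ, V x ≤ M := by
  refine ⟨(eLpNorm V ∞ μ).toReal + 1, by positivity, ?_⟩
  filter_upwards [ae_le_eLpNormEssSup (f := V) (μ := μ)] with x hx
  rw [← eLpNorm_exponent_top] at hx
  have hnorm := ENNReal.toReal_mono hV.2.ne hx
  rw [toReal_enorm] at hnorm
  linarith [Real.le_norm_self (V x)]

theorem memLp_one_div (hV : AEStronglyMeasurable V μ) {δ : ℝ} (hδ : 0 < δ)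
    (hVδ : ∀ᵐ x ∂μ, δ ≤ V x) : MemLp (fun x => ((1 / V x : ℝ) : ℂ)) ∞ μ := by
  have hmeas : AEMeasurable (fun x => ((1 / V x : ℝ) : ℂ)) μ :=
    Complex.measurable_ofReal.comp_aemeasurable (hV.aemeasurable.const_div 1)
  refine memLp_top_of_bound hmeas.aestronglyMeasurable (1 / δ) ?_
  filter_upwards [hVδ] with x hx
  rw [Complex.norm_real, Real.norm_of_nonneg (one_div_pos.2 (hδ.trans_le hx)).le]
  exact one_div_le_one_div_of_le hδ hx

theorem isSymmetric_mulL2 (hg : MemLp (fun x => (g x : ℂ)) ∞ μ) : (mulL2 hg).IsSymmetric := by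
  intro u v
  change inner ℂ (mulL2 hg u) v = inner ℂ u (mulL2 hg v)
  rw [L2.inner_def, L2.inner_def]
  refine integral_congr_ae ?_
  filter_upwards [coeFn_mulL2 hg u, coeFn_mulL2 hg v] with x hu hv
  simp only [hu, hv, RCLike.inner_apply, map_mul, Complex.conj_ofReal]
  ring

theorem mul_norm_sq_le_re_inner_mulL2 (hg : MemLp (fun x => (g x : ℂ)) ∞ μ) {κ : ℝ}
    (hκ : ∀ᵐ x ∂μ, κ ≤ g x) (u : Lp ℂ 2 μ) :
    κ * ‖u‖ ^ 2 ≤ (inner ℂ u (mulL2 hg u)).re := by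
  have hscalar : κ * ‖u‖ ^ 2 = (inner ℂ u ((κ : ℂ) • u)).re := by
    rw [inner_smul_right, Complex.re_ofReal_mul, inner_self_eq_norm_sq_to_K]
    norm_cast
  have hre (a : ℝ) (z : ℂ) : (inner ℂ z (a * z)).re = a * ‖z‖ ^ 2 := by
    rw [← smul_eq_mul, inner_smul_right, inner_self_eq_norm_sq_to_K, Complex.re_ofReal_mul]
    norm_cast
  rw [hscalar, L2.inner_def, L2.inner_def]
  change RCLike.re (K := ℂ) _ ≤ RCLike.re (K := ℂ) _
  rw [← integral_re (L2.integrable_inner _ _), ← integral_re (L2.integrable_inner _ _)]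
  refine integral_mono_ae (L2.integrable_inner _ _).re (L2.integrable_inner _ _).re ?_
  filter_upwards [coeFn_mulL2 hg u, Lp.coeFn_smul (κ : ℂ) u, hκ] with x hmul hsmul hx
  rw [hmul, hsmul, Pi.smul_apply, smul_eq_mul]
  change (inner ℂ _ _).re ≤ (inner ℂ _ _).re
  rw [hre, hre]
  gcongr

theorem coeFn_shifted (lam : ℝ) (u : Lp ℂ 2 μ × Lp ℂ 2 μ) :
    (shifted lam u : Lp ℂ 2 μ) =ᵐ[μ] fun x => u.2 x - (lam : ℂ) * u.1 x := by
  filter_upwards [Lp.coeFn_sub u.2 ((lam : ℂ) • u.1), Lp.coeFn_smul (lam : ℂ) u.1] with x hsub hsmul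
  rw [shifted_apply, hsub, Pi.sub_apply, hsmul, Pi.smul_apply, smul_eq_mul]

end Potential

section TransmissionEigenvalue

variable {V : E n → ℝ} {lam M : ℝ}
  (hinv : MemLp (fun x => ((1 / V x : ℝ) : ℂ)) ∞ (volume.restrict (Ω : Set (E n))))

theorem B_eq_form (hpos : ∀ᵐ x ∂volume.restrict (Ω : Set (E n)), 0 < V x)
    (u v : L2 Ω × L2 Ω) : B V Ω lam u v = form (mulL2 hinv) lam v u := by
  rw [B, form_apply, L2.inner_def, L2.inner_def,
    ← integral_add (L2.integrable_inner _ _) (L2.integrable_inner _ _)]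
  refine integral_congr_ae ?_
  filter_upwards [coeFn_mulL2 hinv (shifted lam u), coeFn_shifted lam u, coeFn_shifted lam v, hpos]
    with x hmul hu hv hx
  have hne : (V x : ℂ) ≠ 0 := Complex.ofReal_ne_zero.2 hx.ne'
  rw [hmul, hu, hv]
  simp only [RCLike.inner_apply, map_sub, map_add, map_mul, Complex.conj_ofReal]
  push_cast
  field_simp
  ring

theorem isCoerciveAt_iff_mem_coercivityPoints
    (hpos : ∀ᵐ x ∂volume.restrict (Ω : Set (E n)), 0 < V x) :
    IsCoerciveAt P V Ω lam ↔ lam ∈ coercivityPoints (mulL2 hinv) (H0Submodule P Ω) := by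
  simp only [IsCoerciveAt, coercivityPoints, qform, B_eq_form hinv hpos, mem_H0Submodule,
    Set.mem_ofPred_eq]

theorem inv_mul_norm_sq_le_re_inner_mulL2
    (hpos : ∀ᵐ x ∂volume.restrict (Ω : Set (E n)), 0 < V x)
    (hVM : ∀ᵐ x ∂volume.restrict (Ω : Set (E n)), V x ≤ M) (u : L2 Ω) :
    M⁻¹ * ‖u‖ ^ 2 ≤ (inner ℂ u (mulL2 hinv u)).re := by
  refine mul_norm_sq_le_re_inner_mulL2 hinv ?_ u
  filter_upwards [hpos, hVM] with x hx hle
  rw [inv_eq_one_div]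
  exact one_div_le_one_div_of_le hx hle

theorem isCoerciveAt_of_lt_abs_symbol_sub
    (hinv : MemLp (fun x => ((1 / V x : ℝ) : ℂ)) ∞ (volume.restrict (Ω : Set (E n))))
    (hpos : ∀ᵐ x ∂volume.restrict (Ω : Set (E n)), 0 < V x)
    (hVM : ∀ᵐ x ∂volume.restrict (Ω : Set (E n)), V x ≤ M) (hM : 0 < M) {K : ℝ}
    (hMK : M < K) (hK : ∀ ξ : E n, K ≤ |symbol P ξ - lam|) : IsCoerciveAt P V Ω lam := by
  refine (isCoerciveAt_iff_mem_coercivityPoints hinv hpos).2 (mem_coercivityPoints (hM.trans hMK)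
    ?_ (inv_mul_norm_sq_le_re_inner_mulL2 hinv hpos hVM)
    fun u hu => mul_norm_fst_le_norm_shifted hK hu)
  rwa [inv_mul_eq_div, one_lt_div hM]

theorem mulL2_shifted_ne_zero
    (hpos : ∀ᵐ x ∂volume.restrict (Ω : Set (E n)), 0 < V x)
    (hΩ : Bornology.IsBounded (Ω : Set (E n)))
    (hP : 1 ≤ P.totalDegree) {u : L2 Ω × L2 Ω} (hu : u ∈ H0Submodule P Ω) (hu₀ : u ≠ 0) :
    mulL2 hinv (shifted lam u) ≠ 0 := by
  have hinv₀ : ∀ᵐ x ∂volume.restrict (Ω : Set (E n)), ((1 / V x : ℝ) : ℂ) ≠ 0 :=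
    hpos.mono fun x hx => Complex.ofReal_ne_zero.2 (one_div_pos.2 hx).ne'
  refine fun hzero => hu₀ (eq_zero_of_norm_shifted_le (lam := lam) hΩ hP le_rfl hu ?_)
  rw [(mulL2_eq_zero_iff hinv hinv₀).1 hzero]
  filter_upwards [Lp.coeFn_zero ℂ 2 (volume.restrict (Ω : Set (E n)))] with x hx
  rw [hx, Pi.zero_apply, norm_zero, zero_mul]

theorem fst_add_mulL2_shifted_ne_zero
    (hpos : ∀ᵐ x ∂volume.restrict (Ω : Set (E n)), 0 < V x)
    (hVM : ∀ᵐ x ∂volume.restrict (Ω : Set (E n)), V x ≤ M)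
    (hΩ : Bornology.IsBounded (Ω : Set (E n)))
    (hP : 1 ≤ P.totalDegree) (hM : 0 ≤ M) {u : L2 Ω × L2 Ω} (hu : u ∈ H0Submodule P Ω)
    (hu₀ : u ≠ 0) : u.1 + mulL2 hinv (shifted lam u) ≠ 0 := by
  refine fun hzero => hu₀ (eq_zero_of_norm_shifted_le (lam := lam) hΩ hP hM hu ?_)
  filter_upwards [Lp.coeFn_add u.1 (mulL2 hinv (shifted lam u)), coeFn_mulL2 hinv (shifted lam u),
    Lp.eq_zero_iff_ae_eq_zero.1 hzero, hpos, hVM] with x hadd hmul hx hVpos hVle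
  rw [hadd, Pi.add_apply, hmul, Pi.zero_apply] at hx
  have hne : (V x : ℂ) ≠ 0 := Complex.ofReal_ne_zero.2 hVpos.ne'
  have hshift : shifted lam u x = -((V x : ℂ) * u.1 x) := by
    push_cast at hx
    field_simp at hx
    linear_combination hx
  rw [hshift, norm_neg, norm_mul, Complex.norm_real, Real.norm_of_nonneg hVpos.le]
  gcongr

theorem solvesWeakly_fst_add_mulL2_shifted {u : L2 Ω × L2 Ω} (hu : u ∈ H0Submodule P Ω)
    (hker : ∀ p ∈ H0Submodule P Ω, form (mulL2 hinv) lam p u = 0) :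
    SolvesWeakly P (fun _ => 0) Ω lam (u.1 + mulL2 hinv (shifted lam u) : L2 Ω) := by
  refine solvesWeakly_of_integral_mul_conj_eq_zero fun p hp => ?_
  have hform : form (mulL2 hinv) lam p u =
      inner ℂ (shifted lam p) (u.1 + mulL2 hinv (shifted lam u)) := by
    rw [form_apply, inner_add_right, inner_shifted_fst (inner_snd_fst_eq_inner_fst_snd hp hu)]
  rw [← hker p hp, hform, L2.inner_def]
  refine integral_congr_ae ?_
  filter_upwards [coeFn_shifted lam p] with x hx
  rw [RCLike.inner_apply, hx, Complex.ofReal_zero, zero_mul, add_zero]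

theorem solvesWeakly_mulL2_shifted
    (hpos : ∀ᵐ x ∂volume.restrict (Ω : Set (E n)), 0 < V x) {u : L2 Ω × L2 Ω}
    (hker : ∀ p ∈ H0Submodule P Ω, form (mulL2 hinv) lam p u = 0) :
    SolvesWeakly P V Ω lam (mulL2 hinv (shifted lam u)) := by
  refine solvesWeakly_of_integral_mul_conj_eq_zero fun p hp => ?_
  rw [← hker p hp, ← B_eq_form hinv hpos, B]
  refine integral_congr_ae ?_
  filter_upwards [coeFn_mulL2 hinv (shifted lam u), coeFn_shifted lam u] with x hmul hu
  rw [hmul, hu]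

theorem isTransmissionEigenvalue_of_form_eq_zero
    (hpos : ∀ᵐ x ∂volume.restrict (Ω : Set (E n)), 0 < V x)
    (hVM : ∀ᵐ x ∂volume.restrict (Ω : Set (E n)), V x ≤ M)
    (hΩ : Bornology.IsBounded (Ω : Set (E n)))
    (hP : 1 ≤ P.totalDegree) (hM : 0 ≤ M) {u : L2 Ω × L2 Ω} (hu : u ∈ H0Submodule P Ω)
    (hu₀ : u ≠ 0) (hker : ∀ p ∈ H0Submodule P Ω, form (mulL2 hinv) lam p u = 0) :
    IsTransmissionEigenvalue P V Ω lam := by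
  have hloc (z : L2 Ω) : MemL2Loc Ω z := fun K _ hK =>
    (Lp.memLp z).mono_measure (Measure.restrict_mono hK le_rfl)
  refine ⟨(u.1 + mulL2 hinv (shifted lam u) : L2 Ω), mulL2 hinv (shifted lam u), hloc _, hloc _,
    ?_, ?_, solvesWeakly_fst_add_mulL2_shifted hinv hu hker,
    solvesWeakly_mulL2_shifted hinv hpos hker, u, mem_H0Submodule.1 hu, ?_⟩
  · rw [← Lp.eq_zero_iff_ae_eq_zero]
    exact fst_add_mulL2_shifted_ne_zero hinv hpos hVM hΩ hP hM hu hu₀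
  · rw [← Lp.eq_zero_iff_ae_eq_zero]
    exact mulL2_shifted_ne_zero hinv hpos hΩ hP hu hu₀
  · filter_upwards [Lp.coeFn_add u.1 (mulL2 hinv (shifted lam u))] with x hx
    rw [hx, Pi.add_apply, add_sub_cancel_right]

end TransmissionEigenvalue

section Existence

variable {V : E n → ℝ} {δ : ℝ}

theorem exists_isCoerciveAt (hV : MemLp V ∞ (volume.restrict (Ω : Set (E n))))
    (hδ : 0 < δ) (hVδ : ∀ᵐ x ∂volume.restrict (Ω : Set (E n)), δ ≤ V x)
    (hP : SemiboundedSymbol P) : ∃ lam, IsCoerciveAt P V Ω lam := by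
  obtain ⟨M, hM, hVM⟩ := exists_ae_le hV
  have hinv := memLp_one_div hV.1 hδ hVδ
  have hpos := hVδ.mono fun x hx => hδ.trans_le hx
  obtain ⟨C, hC⟩ | ⟨C, hC⟩ := hP
  · refine ⟨C - (M + 1), isCoerciveAt_of_lt_abs_symbol_sub hinv hpos hVM hM (lt_add_one M)
      fun ξ => le_trans ?_ (le_abs_self _)⟩
    linarith [hC ξ]
  · refine ⟨-C + (M + 1), isCoerciveAt_of_lt_abs_symbol_sub hinv hpos hVM hM (lt_add_one M)
      fun ξ => le_trans ?_ (neg_le_abs _)⟩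
    linarith [hC ξ]

theorem exists_isTransmissionEigenvalue (hV : MemLp V ∞ (volume.restrict (Ω : Set (E n))))
    (hδ : 0 < δ) (hVδ : ∀ᵐ x ∂volume.restrict (Ω : Set (E n)), δ ≤ V x)
    (hP : 1 ≤ P.totalDegree)
    (hPtilde : Tendsto (symbolTilde P) (cocompact (E n)) atTop)
    (hΩ : Bornology.IsBounded (Ω : Set (E n))) {lam₀ lam : ℝ} (hlam₀ : IsCoerciveAt P V Ω lam₀)
    (hlam : ¬ IsCoerciveAt P V Ω lam) :
    ∃ mu ∈ Set.uIcc lam₀ lam, mu ≠ lam₀ ∧ IsTransmissionEigenvalue P V Ω (mu : ℂ) := by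
  obtain ⟨M, hM, hVM⟩ := exists_ae_le hV
  have hinv := memLp_one_div hV.1 hδ hVδ
  have hpos := hVδ.mono fun x hx => hδ.trans_le hx
  obtain ⟨C, hC⟩ := exists_norm_le hΩ hP
  have hcompact (u : ℕ → L2 Ω × L2 Ω) (hu : ∀ k, u k ∈ H0Submodule P Ω)
      (hsnd : ∀ k, ‖(u k).2‖ ≤ 1) :
      ∃ φ : ℕ → ℕ, StrictMono φ ∧ CauchySeq fun k => (u (φ k)).1 := by
    refine exists_subseq_cauchySeq_fst hΩ hPtilde hu (M := |C|) fun k => (hC _ (hu k)).trans ?_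
    exact (mul_le_mul_of_nonneg_right (le_abs_self C) (norm_nonneg _)).trans
      (mul_le_of_le_one_right (abs_nonneg C) (hsnd k))
  obtain ⟨mu, hmu, hne, u, hu, hu₀, hker⟩ := exists_uIcc_form_eq_zero isClosed_H0Submodule
    (fun u hu v hv => inner_snd_fst_eq_inner_fst_snd hu hv) hC (inv_pos.2 hM)
    (isSymmetric_mulL2 hinv) (inv_mul_norm_sq_le_re_inner_mulL2 hinv hpos hVM)
    hcompact ((isCoerciveAt_iff_mem_coercivityPoints hinv hpos).1 hlam₀)
    ((isCoerciveAt_iff_mem_coercivityPoints hinv hpos).not.1 hlam)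
  exact ⟨mu, hmu, hne, isTransmissionEigenvalue_of_form_eq_zero hinv hpos hVM hΩ hP hM.le hu hu₀
    hker⟩

end Existence

theorem not_isCoerciveAt_of_re_B_nonpos (hΩ : Bornology.IsBounded (Ω : Set (E n)))
    (hP : 1 ≤ P.totalDegree) {V : E n → ℝ} {lam : ℝ} {u : L2 Ω × L2 Ω} (hu : u ∈ H0 P Ω)
    (hu₀ : u ≠ 0) (hB : (B V Ω lam u u).re ≤ 0) : ¬ IsCoerciveAt P V Ω lam := by
  rintro ⟨c, hc, hcoer⟩
  obtain ⟨C, hC⟩ := exists_norm_le hΩ hP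
  have hsnd : u.2 ≠ 0 := fun hzero => hu₀ <| norm_le_zero_iff.1 <| by
    simpa only [hzero, norm_zero, mul_zero] using hC u (mem_H0Submodule.2 hu)
  have hpos : 0 < c * ‖u.2‖ ^ 2 := mul_pos hc (pow_pos (norm_pos_iff.2 hsnd) 2)
  exact (hpos.trans_le (hcoer u hu)).not_ge hB

end ITP

end

theorem theorem4p2_general {n : ℕ} (P : MvPolynomial (Fin n) ℝ) (hP : 1 ≤ P.totalDegree)
    (hPtilde : Tendsto (ITP.symbolTilde P) (cocompact (ITP.E n)) atTop)
    (Ω : TopologicalSpace.Opens (ITP.E n)) (hΩ : Bornology.IsBounded (Ω : Set (ITP.E n)))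
    (V : ITP.E n → ℝ) (hV : MemLp V ∞ (volume.restrict (Ω : Set (ITP.E n))))
    (δ : ℝ) (hδ : 0 < δ) (hVδ : ∀ᵐ x ∂(volume.restrict (Ω : Set (ITP.E n))), δ ≤ V x) :
    (ITP.SemiboundedSymbol P → ∃ lam₀ : ℝ, ITP.IsCoerciveAt P V Ω lam₀) ∧
    ∀ lam₀ : ℝ, ITP.IsCoerciveAt P V Ω lam₀ →
      ∀ lam : ℝ, (∃ u ∈ ITP.H0 P Ω, u ≠ 0 ∧ (ITP.B V Ω lam u u).re ≤ 0) →
        (lam₀ < lam → ∃ mu : ℝ, mu ∈ Set.Ioc lam₀ lam ∧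
          ITP.IsTransmissionEigenvalue P V Ω (mu : ℂ)) ∧
        (lam < lam₀ → ∃ mu : ℝ, mu ∈ Set.Ico lam lam₀ ∧
          ITP.IsTransmissionEigenvalue P V Ω (mu : ℂ)) := by
  refine ⟨ITP.exists_isCoerciveAt hV hδ hVδ, ?_⟩
  rintro lam₀ hlam₀ lam ⟨u, hu, hu₀, hB⟩
  obtain ⟨mu, hmu, hne, heigen⟩ := ITP.exists_isTransmissionEigenvalue hV hδ hVδ hP hPtilde hΩ
    hlam₀ (ITP.not_isCoerciveAt_of_re_B_nonpos hΩ hP hu hu₀ hB)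
  refine ⟨fun hlt => ⟨mu, ?_, heigen⟩, fun hlt => ⟨mu, ?_, heigen⟩⟩
  · rw [Set.uIcc_of_le hlt.le] at hmu
    exact ⟨hmu.1.lt_of_ne' hne, hmu.2⟩
  · rw [Set.uIcc_of_ge hlt.le] at hmu
    exact ⟨hmu.1, hmu.2.lt_of_ne hne⟩

theorem theorem4p2 {n : ℕ} (P : MvPolynomial (Fin n) ℝ) (hP : 2 ≤ P.totalDegree)
    (hPtilde : Tendsto (ITP.symbolTilde P) (cocompact (ITP.E n)) atTop)
    (Ω : TopologicalSpace.Opens (ITP.E n))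
    (hΩconn : IsConnected (Ω : Set (ITP.E n)))
    (hΩbdd : Bornology.IsBounded (Ω : Set (ITP.E n)))
    (V : ITP.E n → ℝ) (hV : MemLp V ∞ volume)
    (hVsupp : ITP.essSupport V = closure (Ω : Set (ITP.E n)))
    (δ : ℝ) (hδ : 0 < δ)
    (hVδ : ∀ᵐ x ∂(volume.restrict (closure (Ω : Set (ITP.E n)))), δ ≤ V x) :
    (ITP.SemiboundedSymbol P → ∃ lam₀ : ℝ, ITP.IsCoerciveAt P V Ω lam₀) ∧
    ∀ lam₀ : ℝ, ITP.IsCoerciveAt P V Ω lam₀ →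
      ∀ lam : ℝ, (∃ u ∈ ITP.H0 P Ω, u ≠ 0 ∧ (ITP.B V Ω lam u u).re ≤ 0) →
        (lam₀ < lam → ∃ mu : ℝ, mu ∈ Set.Ioc lam₀ lam ∧
          ITP.IsTransmissionEigenvalue P V Ω (mu : ℂ)) ∧
        (lam < lam₀ → ∃ mu : ℝ, mu ∈ Set.Ico lam lam₀ ∧
          ITP.IsTransmissionEigenvalue P V Ω (mu : ℂ)) := by
  exact theorem4p2_general P (by omega) hPtilde Ω hΩbdd V (hV.restrict _) δ hδ
    (ae_restrict_of_ae_restrict_of_subset subset_closure hVδ)
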